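/- All graphs are finite and simple. For a connected graph $G$ with vertices $v_1,\dots,v_n$ let $d_{ij}$ be the distance between $v_i$ and $v_j$, and let $\mathcal D(G)=(d_{ij})$ be the distance matrix. The distance signless Laplacian matrix is $\mathcal Q(G)=\mathrm{diag}(tr(v_1),\dots,tr(v_n))+\mathcal D(G)$, where $tr(v_i)=\sum_j d_{ij}$, and the distance signless Laplacian spectral radius $\eta(G)$ is the largest eigenvalue of $\mathcal Q(G)$. A leaf of a tree is a vertex of degree one, and the leaf distance of a tree is the minimum distance between two distinct leaves. Write $\vee$ for the join, $\cup$ for the disjoint union, and $tK_1$ for the disjoint union of $t$ copies of $K_1$. **Theorem.** Let $t\ge 1$ be an integer, and let $G$ be a connected graph of order $n\ge 9t+3$ with minimum degree $\delta(G)\ge t$. If $$\eta(G)\le \eta\bigl(K_t\vee(K_{n-2t}\cup tK_1)\bigr),$$ then $G$ has a spanning tree with leaf distance at least four. -/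

import Mathlib

open SimpleGraph

/-- The join `G ∨ H`: the disjoint union of `G` and `H`, together with all edges between them. -/
def graphJoin {V W : Type*} (G : SimpleGraph V) (H : SimpleGraph W) : SimpleGraph (V ⊕ W) :=
  (G ⊕g H) ⊔ completeBipartiteGraph V W

/-- The graph `K_t ∨ (K_{n-2t} ∪ t K_1)`, of order `n` when `2 * t ≤ n`. The edgeless graph on
`Fin t` is the disjoint union of `t` copies of `K_1`. -/
def extremalGraph (n t : ℕ) : SimpleGraph (Fin t ⊕ (Fin (n - 2 * t) ⊕ Fin t)) :=
  graphJoin (completeGraph (Fin t)) (completeGraph (Fin (n - 2 * t)) ⊕g (⊥ : SimpleGraph (Fin t)))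

/-- The transmission of `v`: the sum of the distances from `v` to all vertices. -/
noncomputable def transmission {V : Type*} [Fintype V] (G : SimpleGraph V) (v : V) : ℕ :=
  ∑ u, G.dist v u

/-- The distance matrix, with entries `G.dist u v`. -/
noncomputable def distanceMatrix {V : Type*} (G : SimpleGraph V) : Matrix V V ℝ :=
  Matrix.of fun u v => (G.dist u v : ℝ)

/-- The distance signless Laplacian matrix `Tr(G) + D(G)`. -/
noncomputable def distanceSignlessLaplacian {V : Type*} [Fintype V] [DecidableEq V]
    (G : SimpleGraph V) : Matrix V V ℝ :=
  Matrix.diagonal (fun v => (transmission G v : ℝ)) + distanceMatrix G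

/-- The distance signless Laplacian spectral radius `η(G)`: the largest (real) eigenvalue of the
distance signless Laplacian matrix. -/
noncomputable def distanceSignlessLaplacianRadius {V : Type*} [Fintype V] [DecidableEq V]
    (G : SimpleGraph V) : ℝ :=
  sSup {x : ℝ | Module.End.HasEigenvalue (Matrix.toLin' (distanceSignlessLaplacian G)) x}

/-- For a nonempty vertex set the supremum in the definition of `η(G)` is attained: `η(G)` is an
eigenvalue, and it is the greatest one. -/
theorem distanceSignlessLaplacianRadius_isGreatest {V : Type*} [Fintype V] [DecidableEq V]
    [Nonempty V] (G : SimpleGraph V) :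
    IsGreatest {x : ℝ | Module.End.HasEigenvalue (Matrix.toLin' (distanceSignlessLaplacian G)) x}
      (distanceSignlessLaplacianRadius G) := by
  have hH : (distanceSignlessLaplacian G).IsHermitian := by
    ext u v
    by_cases h : u = v
    · subst h
      simp [distanceSignlessLaplacian, distanceMatrix]
    · simp [distanceSignlessLaplacian, distanceMatrix, Matrix.diagonal_apply_ne _ h,
        Matrix.diagonal_apply_ne _ (Ne.symm h), SimpleGraph.dist_comm]
  have hs : {x : ℝ | Module.End.HasEigenvalue
      (Matrix.toLin' (distanceSignlessLaplacian G)) x} = Set.range hH.eigenvalues := by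
    rw [← hH.spectrum_real_eq_range_eigenvalues, ← Matrix.spectrum_toLin']
    ext x
    exact Module.End.hasEigenvalue_iff_mem_spectrum
  have hf : (Set.range hH.eigenvalues).Finite := Set.finite_range _
  have hn : (Set.range hH.eigenvalues).Nonempty := Set.range_nonempty _
  unfold distanceSignlessLaplacianRadius
  rw [hs]
  exact ⟨hn.csSup_mem hf, fun x hx => le_csSup hf.bddAbove hx⟩

/-- A leaf of a tree: a vertex of degree one. -/
def IsLeaf {V : Type*} (T : SimpleGraph V) (v : V) : Prop :=
  (T.neighborSet v).ncard = 1

/-- The leaf distance of a tree: the minimum distance between two distinct leaves. (It is `⊤` if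
there are fewer than two leaves, which for a finite tree happens only for the one-vertex tree.) -/
noncomputable def leafDistance {V : Type*} (T : SimpleGraph V) : ℕ∞ :=
  ⨅ (u : V) (v : V) (_ : IsLeaf T u) (_ : IsLeaf T v) (_ : u ≠ v), T.edist u v

/-- `T` is a spanning tree of `G`. -/
def IsSpanningTree {V : Type*} (T G : SimpleGraph V) : Prop :=
  T ≤ G ∧ T.IsTree

/-! Everything depends on whether every nonempty independent set `I` satisfies `|N(I)| > |I|`.

Suppose some `I` fails. Put `S = N(I)`, so `|S| ≥ t` by the minimum degree, and shrink `I` to size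
`s = |S|`. With `R` the remaining vertices, pairs inside `I` and between `I` and `R` have distance
at least two, so the quadratic form of the distance signless Laplacian dominates that of `K_s ∨
(K_{n-2s} ∪ sK_1)` (`joinForm`). If `s > t`, the radius is too large: for `7s ≤ n` test with the
Perron vector of the extremal graph, for `7s ≥ n` with a vector taking two values. So `s = t`, and
the equality case of the Rayleigh bound forces all other pairs to be adjacent
(`adj_of_radius_le_radius_extremalGraph`). Such a graph has a Hamiltonian path, whose two leaves are
far apart.

Suppose the condition holds. The bound `(8n - 12)/3` on the extremal radius is below `3n - 4`, which
forces a vertex of degree above `n/2`. Hall's theorem gives a permutation moving each vertex to a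
neighbour; after splitting even cycles, a permutation `τ` whose cycles are transpositions or odd.
Among connected spanning subgraphs containing all edges `{v, τ v}` take one with the fewest edges
and then the fewest bad leaves. An edge exchange shows that it can be chosen with no bad leaf
(`exists_isOptimalLinkage_badLeaves_eq_empty`); this is where both the strict inequality and the
vertex of large degree enter. Its edges outside `τ` are bridges, so removing one well-chosen edge
from each odd cycle leaves a tree with leaf distance at least four
(`exists_isTree_of_badLeaves_eq_empty`). -/

/-! ### Rayleigh quotients and Perron vectors of the distance signless Laplacian -/

section Rayleigh

open scoped Matrix

variable {V : Type*} [Fintype V] [DecidableEq V]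

theorem isHermitian_distanceSignlessLaplacian (G : SimpleGraph V) :
    (distanceSignlessLaplacian G).IsHermitian := by
  ext u v
  by_cases h : u = v
  · subst h
    simp [distanceSignlessLaplacian, distanceMatrix]
  · simp [distanceSignlessLaplacian, distanceMatrix, Matrix.diagonal_apply_ne _ h,
      Matrix.diagonal_apply_ne _ (Ne.symm h), SimpleGraph.dist_comm]

/-- Each eigenvalue of the difference is the radius minus an eigenvalue of the Laplacian.
Semidefiniteness yields the Rayleigh bound and, through the kernel, its equality case. -/
theorem posSemidef_radius_smul_one_sub (G : SimpleGraph V) :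
    (distanceSignlessLaplacianRadius G • (1 : Matrix V V ℝ)
      - distanceSignlessLaplacian G).PosSemidef := by
  have hH : (distanceSignlessLaplacianRadius G • (1 : Matrix V V ℝ)
      - distanceSignlessLaplacian G).IsHermitian := by
    refine Matrix.IsHermitian.sub ?_ (isHermitian_distanceSignlessLaplacian G)
    ext u v
    simp [Matrix.one_apply, eq_comm]
  rw [hH.posSemidef_iff_eigenvalues_nonneg]
  intro i
  have : Nonempty V := ⟨i⟩
  have hv := hH.mulVec_eigenvectorBasis i
  set x : V → ℝ := ⇑(hH.eigenvectorBasis i) with hx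
  have hx0 : x ≠ 0 := by
    intro h0
    have := (hH.eigenvectorBasis.orthonormal).ne_zero i
    apply this
    ext j
    exact congrFun h0 j
  have hQ : distanceSignlessLaplacian G *ᵥ x
      = (distanceSignlessLaplacianRadius G - hH.eigenvalues i) • x := by
    rw [Matrix.sub_mulVec, Matrix.smul_mulVec, Matrix.one_mulVec] at hv
    rw [sub_smul, ← hv]
    abel
  have hE : Module.End.HasEigenvalue (Matrix.toLin' (distanceSignlessLaplacian G))
      (distanceSignlessLaplacianRadius G - hH.eigenvalues i) := by
    apply Module.End.hasEigenvalue_of_hasEigenvector (x := x)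
    rw [Module.End.hasEigenvector_iff, Module.End.mem_eigenspace_iff]
    exact ⟨by rw [Matrix.toLin'_apply, hQ], hx0⟩
  have := (distanceSignlessLaplacianRadius_isGreatest G).2 hE
  simp only [Pi.zero_apply]
  linarith

theorem dotProduct_mulVec_le_radius (G : SimpleGraph V) (x : V → ℝ) :
    x ⬝ᵥ (distanceSignlessLaplacian G *ᵥ x) ≤
      distanceSignlessLaplacianRadius G * (x ⬝ᵥ x) := by
  have h := (posSemidef_radius_smul_one_sub G).dotProduct_mulVec_nonneg x
  rw [Matrix.sub_mulVec, Matrix.smul_mulVec, Matrix.one_mulVec, dotProduct_sub,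
    dotProduct_smul] at h
  simp only [star_trivial, smul_eq_mul] at h
  linarith

theorem mulVec_eq_of_radius_mul_le (G : SimpleGraph V) (x : V → ℝ)
    (h : distanceSignlessLaplacianRadius G * (x ⬝ᵥ x) ≤
      x ⬝ᵥ (distanceSignlessLaplacian G *ᵥ x)) :
    distanceSignlessLaplacian G *ᵥ x = distanceSignlessLaplacianRadius G • x := by
  have h0 := ((posSemidef_radius_smul_one_sub G).dotProduct_mulVec_zero_iff x).1 (by
    rw [Matrix.sub_mulVec, Matrix.smul_mulVec, Matrix.one_mulVec, dotProduct_sub,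
      dotProduct_smul]
    simp only [star_trivial, smul_eq_mul]
    linarith [dotProduct_mulVec_le_radius G x])
  rw [Matrix.sub_mulVec, Matrix.smul_mulVec, Matrix.one_mulVec, sub_eq_zero] at h0
  exact h0.symm

theorem distanceSignlessLaplacian_mulVec (G : SimpleGraph V) (x : V → ℝ) (i : V) :
    (distanceSignlessLaplacian G *ᵥ x) i = ∑ j, (G.dist i j : ℝ) * (x i + x j) := by
  rw [distanceSignlessLaplacian, Matrix.add_mulVec, Pi.add_apply, Matrix.mulVec_diagonal,
    transmission, distanceMatrix]
  simp only [Matrix.mulVec, dotProduct, Matrix.of_apply, mul_add, Finset.sum_add_distrib,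
    Nat.cast_sum, Finset.sum_mul]

/-- Symmetrizing over ordered pairs produces the factor two. In this shape the form is visibly
monotone in the distances. -/
theorem two_mul_dotProduct_mulVec (G : SimpleGraph V) (x : V → ℝ) :
    2 * (x ⬝ᵥ (distanceSignlessLaplacian G *ᵥ x))
      = ∑ i, ∑ j, (G.dist i j : ℝ) * (x i + x j) ^ 2 := by
  have h1 : x ⬝ᵥ (distanceSignlessLaplacian G *ᵥ x)
      = ∑ i, ∑ j, (G.dist i j : ℝ) * (x i * (x i + x j)) := by
    simp only [dotProduct, distanceSignlessLaplacian_mulVec, Finset.mul_sum]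
    exact Finset.sum_congr rfl fun i _ => Finset.sum_congr rfl fun j _ => by ring
  have h2 : x ⬝ᵥ (distanceSignlessLaplacian G *ᵥ x)
      = ∑ i, ∑ j, (G.dist i j : ℝ) * (x j * (x i + x j)) := by
    rw [h1, Finset.sum_comm]
    exact Finset.sum_congr rfl fun i _ => Finset.sum_congr rfl fun j _ => by
      rw [SimpleGraph.dist_comm]; ring
  rw [two_mul]
  nth_rw 1 [h1]
  rw [h2, ← Finset.sum_add_distrib]
  refine Finset.sum_congr rfl fun i _ => ?_
  rw [← Finset.sum_add_distrib]
  exact Finset.sum_congr rfl fun j _ => by ring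

/-- A positive eigenvector for the distance signless Laplacian spectral radius. -/
theorem exists_pos_eigenvector [Nontrivial V] (G : SimpleGraph V) (hG : G.Connected) :
    ∃ y : V → ℝ, (∀ v, 0 < y v) ∧
      distanceSignlessLaplacian G *ᵥ y = distanceSignlessLaplacianRadius G • y := by
  obtain ⟨x, hx⟩ := (distanceSignlessLaplacianRadius_isGreatest G).1.exists_hasEigenvector
  rw [Module.End.hasEigenvector_iff, Module.End.mem_eigenspace_iff, Matrix.toLin'_apply] at hx
  obtain ⟨hx, hx0⟩ := hx
  set y : V → ℝ := fun v => |x v| with hy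
  have hyy : y ⬝ᵥ y = x ⬝ᵥ x := by simp [hy, dotProduct]
  -- Taking absolute values does not decrease the form, so `y` also attains the maximum and is
  -- itself an eigenvector.
  have hle : x ⬝ᵥ (distanceSignlessLaplacian G *ᵥ x)
      ≤ y ⬝ᵥ (distanceSignlessLaplacian G *ᵥ y) := by
    have h1 := two_mul_dotProduct_mulVec G x
    have h2 := two_mul_dotProduct_mulVec G y
    have : ∑ i, ∑ j, (G.dist i j : ℝ) * (x i + x j) ^ 2
        ≤ ∑ i, ∑ j, (G.dist i j : ℝ) * (y i + y j) ^ 2 := by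
      refine Finset.sum_le_sum fun i _ => Finset.sum_le_sum fun j _ => ?_
      refine mul_le_mul_of_nonneg_left ?_ (Nat.cast_nonneg _)
      rw [sq_le_sq]
      exact (abs_add_le _ _).trans (le_abs_self _)
    linarith
  have hmul := mulVec_eq_of_radius_mul_le G y (by
    rw [hyy]
    refine le_trans (le_of_eq ?_) hle
    rw [hx, dotProduct_smul, smul_eq_mul])
  refine ⟨y, fun v => ?_, hmul⟩
  by_contra hv
  have hyv : y v = 0 := le_antisymm (not_lt.1 hv) (abs_nonneg _)
  -- At a zero entry the eigenvalue equation is a vanishing sum of nonnegative terms with positive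
  -- distances off `v`, so all entries vanish.
  have h0 := congrFun hmul v
  rw [distanceSignlessLaplacian_mulVec, Pi.smul_apply, hyv, smul_zero] at h0
  rw [Finset.sum_eq_zero_iff_of_nonneg (fun j _ =>
    mul_nonneg (Nat.cast_nonneg _) (by rw [zero_add]; exact abs_nonneg _))] at h0
  apply hx0
  funext j
  by_cases hjv : j = v
  · subst hjv; simpa [hy] using hyv
  · have := h0 j (Finset.mem_univ _)
    rw [zero_add, mul_eq_zero] at this
    rcases this with h | h
    · exact absurd (Nat.cast_eq_zero.1 h) (hG.pos_dist_of_ne (Ne.symm hjv)).ne'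
    · simpa [hy] using h

theorem transmission_le_radius_of_pos (G : SimpleGraph V) {y : V → ℝ} (hy : ∀ v, 0 < y v)
    (h : distanceSignlessLaplacian G *ᵥ y = distanceSignlessLaplacianRadius G • y) (v : V) :
    (transmission G v : ℝ) ≤ distanceSignlessLaplacianRadius G := by
  have h0 := congrFun h v
  rw [distanceSignlessLaplacian_mulVec, Pi.smul_apply, smul_eq_mul] at h0
  have : (transmission G v : ℝ) * y v ≤ distanceSignlessLaplacianRadius G * y v := by
    rw [← h0, transmission, Nat.cast_sum, Finset.sum_mul]
    refine Finset.sum_le_sum fun j _ => ?_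
    exact mul_le_mul_of_nonneg_left (by linarith [hy j]) (Nat.cast_nonneg _)
  exact le_of_mul_le_mul_right this (hy v)

/-- Vertices with the same distances to all other vertices have equal entries in a positive
eigenvector. -/
theorem eigenvector_eq_of_twins (G : SimpleGraph V) (hG : G.Connected) {y : V → ℝ}
    (hy : ∀ v, 0 < y v)
    (h : distanceSignlessLaplacian G *ᵥ y = distanceSignlessLaplacianRadius G • y) {u v : V}
    (huv : ∀ w, w ≠ u → w ≠ v → G.dist u w = G.dist v w) : y u = y v := by
  by_cases hne : u = v
  · rw [hne]
  have key : ∀ a b : V, a ≠ b → ((transmission G a : ℝ)) * y a + G.dist a b * y b +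
      ∑ w ∈ (Finset.univ.erase a).erase b, (G.dist a w : ℝ) * y w
      = distanceSignlessLaplacianRadius G * y a := by
    intro a b hab
    have h0 := congrFun h a
    rw [distanceSignlessLaplacian_mulVec, Pi.smul_apply, smul_eq_mul] at h0
    simp only [mul_add, Finset.sum_add_distrib] at h0
    rw [← Finset.sum_mul, ← Nat.cast_sum] at h0
    rw [← h0, ← Finset.add_sum_erase Finset.univ (fun w => (G.dist a w : ℝ) * y w)
        (Finset.mem_univ a),
      ← Finset.add_sum_erase _ _ (Finset.mem_erase.2 ⟨hab.symm, Finset.mem_univ b⟩)]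
    simp [transmission, add_assoc]
  have tr : transmission G u = transmission G v := by
    unfold transmission
    rw [← Finset.add_sum_erase Finset.univ _ (Finset.mem_univ u),
      ← Finset.add_sum_erase (Finset.univ.erase u) _
        (Finset.mem_erase.2 ⟨Ne.symm hne, Finset.mem_univ v⟩),
      ← Finset.add_sum_erase Finset.univ (fun w => G.dist v w) (Finset.mem_univ u),
      ← Finset.add_sum_erase (Finset.univ.erase u) (fun w => G.dist v w)
        (Finset.mem_erase.2 ⟨Ne.symm hne, Finset.mem_univ v⟩)]
    rw [Finset.sum_congr rfl (g := fun w => G.dist v w) (fun w hw => huv w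
      (by simp at hw; tauto) (by simp at hw; tauto))]
    simp [SimpleGraph.dist_comm]
  have hu := key u v hne
  have hv := key v u (Ne.symm hne)
  rw [Finset.erase_right_comm] at hv
  rw [Finset.sum_congr rfl (g := fun w => (G.dist v w : ℝ) * y w) (fun w hw => by
    rw [huv w (by simp at hw; tauto) (by simp at hw; tauto)])] at hu
  have hle := transmission_le_radius_of_pos G hy h u
  have hpos : (0 : ℝ) < G.dist u v := Nat.cast_pos.2 (hG.pos_dist_of_ne hne)
  rw [SimpleGraph.dist_comm (u := v), ← tr] at hv
  -- The difference of the two eigenvalue equations; the first factor is positive because the radius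
  -- is at least the transmission.
  have : (distanceSignlessLaplacianRadius G - transmission G u + G.dist u v) * (y u - y v) = 0 := by
    linarith
  rcases mul_eq_zero.1 this with h | h
  · linarith
  · linarith

end Rayleigh

/-! ### The extremal graph: distances, quotient matrix, upper bound on its radius -/

section ExtremalGraph

open scoped Matrix

theorem extremalGraph_adj_inl {n t : ℕ} (i : Fin t) (x : Fin t ⊕ (Fin (n - 2 * t) ⊕ Fin t)) :
    (extremalGraph n t).Adj (Sum.inl i) x ↔ x ≠ Sum.inl i := by
  rcases x with x | x <;> simp [extremalGraph, graphJoin, eq_comm]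

theorem extremalGraph_adj_inr_inl {n t : ℕ} (i j : Fin (n - 2 * t)) :
    (extremalGraph n t).Adj (Sum.inr (Sum.inl i)) (Sum.inr (Sum.inl j)) ↔ i ≠ j := by
  simp [extremalGraph, graphJoin]

theorem not_extremalGraph_adj_inr_inr {n t : ℕ} (i : Fin t) (x : Fin (n - 2 * t) ⊕ Fin t) :
    ¬ (extremalGraph n t).Adj (Sum.inr (Sum.inr i)) (Sum.inr x) := by
  rcases x with x | x <;> simp [extremalGraph, graphJoin]

theorem extremalGraph_connected {n t : ℕ} (ht : 1 ≤ t) : (extremalGraph n t).Connected := by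
  rw [connected_iff_exists_forall_reachable]
  refine ⟨Sum.inl ⟨0, ht⟩, fun w => ?_⟩
  by_cases h : w = Sum.inl ⟨0, ht⟩
  · rw [h]
  · exact ((extremalGraph_adj_inl _ w).2 h).reachable

theorem SimpleGraph.dist_eq_two_of_common_neighbor {V : Type*} {G : SimpleGraph V} {u v w : V}
    (huv : u ≠ v) (h : ¬ G.Adj u v) (h1 : G.Adj u w) (h2 : G.Adj w v) : G.dist u v = 2 := by
  have hle : G.dist u v ≤ 2 := dist_le (Walk.cons h1 (Walk.cons h2 Walk.nil))
  have h0 : 0 < G.dist u v := (Reachable.trans h1.reachable h2.reachable).pos_dist_of_ne huv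
  have h1 : G.dist u v ≠ 1 := fun h' => h (dist_eq_one_iff_adj.1 h')
  omega

theorem extremalGraph_dist_inl {n t : ℕ} (i : Fin t) (x : Fin t ⊕ (Fin (n - 2 * t) ⊕ Fin t)) :
    (extremalGraph n t).dist (Sum.inl i) x = if x = Sum.inl i then 0 else 1 := by
  split_ifs with h
  · rw [h, dist_self]
  · exact dist_eq_one_iff_adj.2 ((extremalGraph_adj_inl _ _).2 h)

theorem extremalGraph_dist_inr_inl {n t : ℕ} (i j : Fin (n - 2 * t)) :
    (extremalGraph n t).dist (Sum.inr (Sum.inl i)) (Sum.inr (Sum.inl j))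
      = if i = j then 0 else 1 := by
  split_ifs with h
  · rw [h, dist_self]
  · exact dist_eq_one_iff_adj.2 ((extremalGraph_adj_inr_inl _ _).2 h)

theorem extremalGraph_dist_inr_inr {n t : ℕ} (i : Fin t) (x : Fin (n - 2 * t) ⊕ Fin t) :
    (extremalGraph n t).dist (Sum.inr (Sum.inr i)) (Sum.inr x)
      = if x = Sum.inr i then 0 else 2 := by
  split_ifs with h
  · rw [h, dist_self]
  · refine dist_eq_two_of_common_neighbor (w := Sum.inl ⟨0, i.pos⟩) ?_
      (not_extremalGraph_adj_inr_inr _ _) ?_ ?_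
    · simpa [eq_comm] using h
    · exact ((extremalGraph_adj_inl _ _).2 (by simp)).symm
    · exact (extremalGraph_adj_inl _ _).2 (by simp)

/-- The eigenvalue equations of the quotient matrix of the extremal graph. -/
theorem exists_extremalGraph_quotient_eigenvector {n t : ℕ} (ht : 1 ≤ t) (hn : 2 * t < n) :
    ∃ a b c : ℝ, 0 < a ∧ 0 < b ∧ 0 < c ∧
      distanceSignlessLaplacianRadius (extremalGraph n t) * a
        = (n + t - 2) * a + (n - 2 * t) * b + t * c ∧
      distanceSignlessLaplacianRadius (extremalGraph n t) * b
        = t * a + (2 * n - t - 2) * b + 2 * t * c ∧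
      distanceSignlessLaplacianRadius (extremalGraph n t) * c
        = t * a + 2 * (n - 2 * t) * b + (2 * n + t - 4) * c := by
  have : Nontrivial (Fin t ⊕ (Fin (n - 2 * t) ⊕ Fin t)) :=
    ⟨⟨Sum.inl ⟨0, ht⟩, Sum.inr (Sum.inr ⟨0, ht⟩), by simp⟩⟩
  obtain ⟨y, hy, hQ⟩ := exists_pos_eigenvector _ (extremalGraph_connected (n := n) ht)
  have hp : 0 < n - 2 * t := by omega
  have hcast : ((n - 2 * t : ℕ) : ℝ) = n - 2 * t := by
    rw [Nat.cast_sub hn.le]; push_cast; ring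
  set a := y (Sum.inl ⟨0, ht⟩) with ha
  set b := y (Sum.inr (Sum.inl ⟨0, hp⟩)) with hb
  set c := y (Sum.inr (Sum.inr ⟨0, ht⟩)) with hc
  have ya : ∀ i, y (Sum.inl i) = a := fun i => by
    refine eigenvector_eq_of_twins _ (extremalGraph_connected ht) hy hQ fun w h1 h2 => ?_
    rw [extremalGraph_dist_inl, extremalGraph_dist_inl, if_neg h1, if_neg h2]
  have yb : ∀ i, y (Sum.inr (Sum.inl i)) = b := fun i => by
    refine eigenvector_eq_of_twins _ (extremalGraph_connected ht) hy hQ fun w h1 h2 => ?_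
    rcases w with w | w | w
    · rw [SimpleGraph.dist_comm, extremalGraph_dist_inl, SimpleGraph.dist_comm,
        extremalGraph_dist_inl]
      simp
    · rw [extremalGraph_dist_inr_inl, extremalGraph_dist_inr_inl, if_neg, if_neg]
      · rintro rfl; simp at h2
      · rintro rfl; simp at h1
    · rw [SimpleGraph.dist_comm, extremalGraph_dist_inr_inr, SimpleGraph.dist_comm,
        extremalGraph_dist_inr_inr]
      simp
  have yc : ∀ i, y (Sum.inr (Sum.inr i)) = c := fun i => by
    refine eigenvector_eq_of_twins _ (extremalGraph_connected ht) hy hQ fun w h1 h2 => ?_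
    rcases w with w | w
    · rw [SimpleGraph.dist_comm, extremalGraph_dist_inl, SimpleGraph.dist_comm,
        extremalGraph_dist_inl]
      simp
    · rw [extremalGraph_dist_inr_inr, extremalGraph_dist_inr_inr, if_neg, if_neg]
      · rintro rfl; simp at h2
      · rintro rfl; simp at h1
  have ite_sum : ∀ (m : ℕ) (i : Fin m) (k z : ℝ),
      ∑ j : Fin m, (if j = i then 0 else k) * z = (m - 1) * k * z := by
    intro m i k z
    have : ∀ j : Fin m, (if j = i then 0 else k) * z = k * z - if j = i then k * z else 0 := by
      intro j; split_ifs <;> ring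
    simp only [this, Finset.sum_sub_distrib, Finset.sum_ite_eq', Finset.mem_univ, if_true,
      Finset.sum_const, Finset.card_univ, Fintype.card_fin, nsmul_eq_mul]
    ring
  refine ⟨a, b, c, hy _, hy _, hy _, ?_, ?_, ?_⟩
  · have h := congrFun hQ (Sum.inl ⟨0, ht⟩)
    rw [distanceSignlessLaplacian_mulVec, Pi.smul_apply, smul_eq_mul, Fintype.sum_sum_type,
      Fintype.sum_sum_type] at h
    simp only [extremalGraph_dist_inl, ya, yb, yc, Sum.inl.injEq, Nat.cast_ite, Nat.cast_zero,
      Nat.cast_one, ite_sum, reduceCtorEq, if_false, Finset.sum_const, Finset.card_univ,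
      Fintype.card_fin, nsmul_eq_mul, hcast] at h
    linarith
  · have h := congrFun hQ (Sum.inr (Sum.inl ⟨0, hp⟩))
    rw [distanceSignlessLaplacian_mulVec, Pi.smul_apply, smul_eq_mul, Fintype.sum_sum_type,
      Fintype.sum_sum_type] at h
    simp only [SimpleGraph.dist_comm (u := Sum.inr (Sum.inl (⟨0, hp⟩ : Fin (n - 2 * t)))),
      extremalGraph_dist_inl, extremalGraph_dist_inr_inl, extremalGraph_dist_inr_inr,
      ya, yb, yc, Nat.cast_ite, Nat.cast_zero, Nat.cast_ofNat,
      Nat.cast_one, ite_sum, reduceCtorEq, if_false, Finset.sum_const, Finset.card_univ,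
      Fintype.card_fin, nsmul_eq_mul, hcast] at h
    linarith
  · have h := congrFun hQ (Sum.inr (Sum.inr ⟨0, ht⟩))
    rw [distanceSignlessLaplacian_mulVec, Pi.smul_apply, smul_eq_mul, Fintype.sum_sum_type,
      Fintype.sum_sum_type] at h
    simp only [SimpleGraph.dist_comm (v := Sum.inl _),
      extremalGraph_dist_inl, extremalGraph_dist_inr_inr, Sum.inr.injEq,
      ya, yb, yc, Nat.cast_ite, Nat.cast_zero, Nat.cast_ofNat,
      Nat.cast_one, ite_sum, reduceCtorEq, if_false, Finset.sum_const, Finset.card_univ,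
      Fintype.card_fin, nsmul_eq_mul, hcast] at h
    linarith

/-- Pair the Perron vector with the weights `(1, 1, 3)` on the three classes. The Laplacian maps
this weight vector to at most `(8n - 12)/3` times itself entrywise, with equality on the independent
class; on the clique class this is exactly `n ≥ 9t + 3`. -/
theorem radius_extremalGraph_le {n t : ℕ} (ht : 1 ≤ t) (hn : 9 * t + 3 ≤ n) :
    distanceSignlessLaplacianRadius (extremalGraph n t) ≤ (8 * n - 12) / 3 := by
  obtain ⟨a, b, c, ha, hb, hc, ea, eb, ec⟩ :=
    exists_extremalGraph_quotient_eigenvector ht (by omega : 2 * t < n)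
  set l := distanceSignlessLaplacianRadius (extremalGraph n t)
  have ht' : (1 : ℝ) ≤ t := by exact_mod_cast ht
  have hn' : (9 : ℝ) * t + 3 ≤ n := by exact_mod_cast hn
  have hw : (0 : ℝ) < t * a + (n - 2 * t) * b + 3 * t * c := by
    have : (0 : ℝ) < n - 2 * t := by linarith
    positivity
  refine le_of_mul_le_mul_right ?_ hw
  have e : l * (t * a + (n - 2 * t) * b + 3 * t * c) = t * ((2 * n - 2 + 2 * t) * a)
      + (n - 2 * t) * ((2 * n - 2 + 6 * t) * b) + t * ((8 * n - 12) * c) := by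
    linear_combination (t : ℝ) * ea + (n - 2 * t : ℝ) * eb + 3 * (t : ℝ) * ec
  rw [e]
  have h1 : (2 * n - 2 + 2 * t : ℝ) * a ≤ (8 * n - 12) / 3 * a :=
    mul_le_mul_of_nonneg_right (by linarith) ha.le
  have h2 : (2 * n - 2 + 6 * t : ℝ) * b ≤ (8 * n - 12) / 3 * b :=
    mul_le_mul_of_nonneg_right (by linarith) hb.le
  have h3 := mul_le_mul_of_nonneg_left h1 (by linarith : (0 : ℝ) ≤ t)
  have h4 := mul_le_mul_of_nonneg_left h2 (by linarith : (0 : ℝ) ≤ n - 2 * t)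
  linarith

end ExtremalGraph

/-! ### Lower bounds on the quadratic form -/

section LowerBounds

open scoped Matrix

variable {V : Type*} [Fintype V] [DecidableEq V]

/-- Each transmission is at least `2(n - 1) - deg v`. If all degrees were at most `n/2`, the
all-ones vector would have Rayleigh quotient at least `3n - 4`. -/
theorem exists_degree_gt_half_of_radius_lt (G : SimpleGraph V) [DecidableRel G.Adj]
    (hG : G.Connected)
    (h : distanceSignlessLaplacianRadius G < 3 * Fintype.card V - 4) :
    ∃ v, Fintype.card V < 2 * G.degree v := by
  by_contra! hd
  have h1 := dotProduct_mulVec_le_radius G (fun _ => 1)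
  have h2 := two_mul_dotProduct_mulVec G (fun _ => 1)
  have htr : ∀ v, ((3 * Fintype.card V - 4 : ℝ)) * 2 ≤
      ∑ u, (G.dist v u : ℝ) * ((fun _ => (1 : ℝ)) v + (fun _ => (1 : ℝ)) u) ^ 2 := by
    intro v
    have hu : ∀ u, (8 : ℝ) - (if u = v then 8 else 0) - (if G.Adj v u then 4 else 0) ≤
        (G.dist v u : ℝ) * ((fun _ => (1 : ℝ)) v + (fun _ => (1 : ℝ)) u) ^ 2 := by
      intro u
      by_cases huv : u = v
      · subst huv; simp
      · have h0 : 1 ≤ G.dist v u := hG.pos_dist_of_ne (Ne.symm huv)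
        have h0' : (1 : ℝ) ≤ G.dist v u := by exact_mod_cast h0
        by_cases hadj : G.Adj v u
        · simp only [huv, hadj, if_true, if_false]; linarith
        · have : G.dist v u ≠ 1 := fun h' => hadj (dist_eq_one_iff_adj.1 h')
          have : (2 : ℝ) ≤ G.dist v u := by exact_mod_cast (by omega : 2 ≤ G.dist v u)
          simp only [huv, hadj, if_false]; linarith
    refine le_trans ?_ (Finset.sum_le_sum fun u _ => hu u)
    rw [Finset.sum_sub_distrib, Finset.sum_sub_distrib, Finset.sum_ite_eq',
      ← Finset.sum_filter, Finset.sum_const, Finset.sum_const]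
    have hdeg : (Finset.univ.filter fun u => G.Adj v u).card = G.degree v := by
      rw [← card_neighborFinset_eq_degree, neighborFinset_eq_filter]
    have : (2 * G.degree v : ℝ) ≤ Fintype.card V := by exact_mod_cast hd v
    simp only [hdeg, nsmul_eq_mul, Finset.mem_univ, if_true, Finset.card_univ]
    linarith
  have h3 := Finset.sum_le_sum fun v (_ : v ∈ Finset.univ) => htr v
  rw [← h2, Finset.sum_const, nsmul_eq_mul, Finset.card_univ] at h3
  have h4 : (fun _ : V => (1 : ℝ)) ⬝ᵥ (fun _ => 1) = Fintype.card V := by simp [dotProduct]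
  rw [h4] at h1
  have hpos : (0 : ℝ) < Fintype.card V := by
    have := hG.nonempty
    exact_mod_cast Fintype.card_pos
  have := mul_lt_mul_of_pos_right h hpos
  linarith

theorem sum_sum_add_sq {V : Type*} (A B : Finset V) (x : V → ℝ) :
    ∑ u ∈ A, ∑ v ∈ B, (x u + x v) ^ 2 = B.card * ∑ u ∈ A, x u ^ 2
      + 2 * (∑ u ∈ A, x u) * (∑ v ∈ B, x v) + A.card * ∑ v ∈ B, x v ^ 2 := by
  have : ∀ u v, (x u + x v) ^ 2 = x u ^ 2 + 2 * x u * x v + x v ^ 2 := fun u v => by ring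
  simp only [this, Finset.sum_add_distrib, Finset.sum_const, nsmul_eq_mul, ← Finset.mul_sum,
    ← Finset.sum_mul]

/-- The value of `xᵀ Q x`, where `Q` is the distance signless Laplacian of the graph in which `I`
is independent, there are no edges between `I` and `R`, and all other pairs are adjacent. -/
def joinForm (I R : Finset V) (x : V → ℝ) : ℝ :=
  (Fintype.card V - 2) * ∑ v, x v ^ 2 + (∑ v, x v) ^ 2
    + ((I.card + R.card - 2) * ∑ v ∈ I, x v ^ 2 + (∑ v ∈ I, x v) ^ 2)
    + 2 * (∑ v ∈ I, x v) * (∑ v ∈ R, x v) + I.card * ∑ v ∈ R, x v ^ 2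

theorem two_mul_joinForm (I R : Finset V) (hIR : Disjoint I R) (x : V → ℝ) :
    2 * joinForm I R x = ∑ u, ∑ v, (if u = v then 0 else
      if (u ∈ I ∧ v ∈ I) ∨ (u ∈ I ∧ v ∈ R) ∨ (v ∈ I ∧ u ∈ R) then 2 else 1) * (x u + x v) ^ 2 := by
  -- Weight one on all pairs, an extra one on the pairs `I × I`, `I × R`, `R × I`, minus the
  -- diagonal contributions.
  have hterm : ∀ u v : V, (if u = v then (0 : ℝ) else
      if (u ∈ I ∧ v ∈ I) ∨ (u ∈ I ∧ v ∈ R) ∨ (v ∈ I ∧ u ∈ R) then 2 else 1) * (x u + x v) ^ 2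
      = (x u + x v) ^ 2 - (if u = v then 4 * x u ^ 2 else 0)
      + (if u ∈ I then if v ∈ I then (x u + x v) ^ 2 else 0 else 0)
      - (if u = v then if u ∈ I then 4 * x u ^ 2 else 0 else 0)
      + (if u ∈ I then if v ∈ R then (x u + x v) ^ 2 else 0 else 0)
      + (if u ∈ R then if v ∈ I then (x u + x v) ^ 2 else 0 else 0) := by
    intro u v
    have hd : ∀ w, w ∈ I → w ∉ R := fun w h1 h2 => Finset.disjoint_left.1 hIR h1 h2
    by_cases huv : u = v
    · subst huv
      by_cases h1 : u ∈ I
      · have := hd u h1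
        simp [h1, this]; ring
      · simp [h1]; ring
    · by_cases h1 : u ∈ I <;> by_cases h2 : v ∈ I <;> by_cases h3 : u ∈ R <;>
        by_cases h4 : v ∈ R <;>
        first
        | exact absurd h3 (hd u h1)
        | exact absurd h4 (hd v h2)
        | (simp [huv, h1, h2, h3, h4]; try ring)
  simp only [hterm, Finset.sum_add_distrib, Finset.sum_sub_distrib, Finset.sum_ite_eq,
    Finset.mem_univ, if_true, Finset.sum_ite_irrel, Finset.sum_const_zero,
    Finset.sum_ite_mem, Finset.univ_inter, ← Finset.mul_sum]
  rw [sum_sum_add_sq, sum_sum_add_sq, sum_sum_add_sq, sum_sum_add_sq, joinForm]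
  rw [Finset.card_univ]
  ring

theorem joinForm_weight_le_dist {V : Type*} [DecidableEq V] (G : SimpleGraph V) (hG : G.Connected) (I R : Finset V)
    (h : ∀ u ∈ I, ∀ v, v ∈ I ∨ v ∈ R → ¬ G.Adj u v) (u v : V) :
    (if u = v then (0 : ℝ) else
      if (u ∈ I ∧ v ∈ I) ∨ (u ∈ I ∧ v ∈ R) ∨ (v ∈ I ∧ u ∈ R) then 2 else 1) ≤ G.dist u v := by
  split_ifs with huv hp
  · exact Nat.cast_nonneg _
  · have hadj : ¬ G.Adj u v := by
      rcases hp with hp | hp | hp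
      · exact h u hp.1 v (Or.inl hp.2)
      · exact h u hp.1 v (Or.inr hp.2)
      · exact fun h' => h v hp.1 u (Or.inr hp.2) h'.symm
    have h0 : 1 ≤ G.dist u v := hG.pos_dist_of_ne huv
    have : G.dist u v ≠ 1 := fun h' => hadj (dist_eq_one_iff_adj.1 h')
    exact_mod_cast (by omega : 2 ≤ G.dist u v)
  · exact_mod_cast (hG.pos_dist_of_ne huv : 1 ≤ G.dist u v)

theorem joinForm_le_dotProduct_mulVec (G : SimpleGraph V) (hG : G.Connected) (I R : Finset V)
    (hIR : Disjoint I R) (h : ∀ u ∈ I, ∀ v, v ∈ I ∨ v ∈ R → ¬ G.Adj u v) (x : V → ℝ) :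
    joinForm I R x ≤ x ⬝ᵥ (distanceSignlessLaplacian G *ᵥ x) := by
  have h1 := two_mul_dotProduct_mulVec G x
  have h2 := two_mul_joinForm I R hIR x
  have h3 := Finset.sum_le_sum fun u (_ : u ∈ Finset.univ) => Finset.sum_le_sum
    fun v (_ : v ∈ Finset.univ) => mul_le_mul_of_nonneg_right
      (joinForm_weight_le_dist G hG I R h u v) (sq_nonneg (x u + x v))
  linarith

/-- One further non-adjacent pair already makes the comparison strict at a positive vector; this
settles the equality case. -/
theorem joinForm_lt_dotProduct_mulVec (G : SimpleGraph V) (hG : G.Connected) (I R : Finset V)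
    (hIR : Disjoint I R) (h : ∀ u ∈ I, ∀ v, v ∈ I ∨ v ∈ R → ¬ G.Adj u v) {x : V → ℝ}
    (hx : ∀ v, 0 < x v) {p q : V} (hpq : p ≠ q) (hadj : ¬ G.Adj p q)
    (hn : ¬ ((p ∈ I ∧ q ∈ I) ∨ (p ∈ I ∧ q ∈ R) ∨ (q ∈ I ∧ p ∈ R))) :
    joinForm I R x < x ⬝ᵥ (distanceSignlessLaplacian G *ᵥ x) := by
  have h1 := two_mul_dotProduct_mulVec G x
  have h2 := two_mul_joinForm I R hIR x
  have hle := fun u v => mul_le_mul_of_nonneg_right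
    (joinForm_weight_le_dist G hG I R h u v) (sq_nonneg (x u + x v))
  have h3 := Finset.sum_lt_sum (fun u (_ : u ∈ Finset.univ) => Finset.sum_le_sum
    fun v (_ : v ∈ Finset.univ) => hle u v) ⟨p, Finset.mem_univ p,
      Finset.sum_lt_sum (fun v _ => hle p v) ⟨q, Finset.mem_univ q, ?_⟩⟩
  · linarith
  · rw [if_neg hpq, if_neg hn]
    refine mul_lt_mul_of_pos_right ?_ (by have := hx p; have := hx q; positivity)
    have h0 : 1 ≤ G.dist p q := hG.pos_dist_of_ne hpq
    have : G.dist p q ≠ 1 := fun h' => hadj (dist_eq_one_iff_adj.1 h')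
    exact_mod_cast (by omega : 1 < G.dist p q)

end LowerBounds

/-! ### Comparison with the extremal graph -/

section Comparison

open scoped Matrix

/-- This is the sign of the surplus of `joinForm` over the extremal form when `s > t`. The
hypothesis `7s ≤ n` replaces `4n - 6s` by `22n/7`. -/
theorem mul_add_sq_lt_of_quotient_eigenvector {n t s l a b c : ℝ} (ht : 0 < t)
    (hn : 9 * t + 3 ≤ n) (hs : 7 * s ≤ n) (ha : 0 < a) (hb : 0 < b) (hc : 0 < c)
    (eb : l * b = t * a + (2 * n - t - 2) * b + 2 * t * c)
    (ec : l * c = t * a + 2 * (n - 2 * t) * b + (2 * n + t - 4) * c) :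
    t * (b + c) ^ 2 < b ^ 2 * (4 * n - 2 * t - 6 * s - 2) := by
  -- Eliminating `l` from the two eigenvalue equations bounds `t c²` by a multiple of `(n - 2t) b²`
  -- once `c` is well above `b`; otherwise `c ≤ 7b/2` suffices directly.
  have key : t * (a + 2 * c) * (c - b) + 2 * b * c = (2 * n - 4 * t) * b ^ 2 := by
    linear_combination b * ec - c * eb
  have hb2 : 0 < b ^ 2 := by positivity
  have hlow : b ^ 2 * (22 / 7 * n - 2 * t - 2) ≤ b ^ 2 * (4 * n - 2 * t - 6 * s - 2) :=
    mul_le_mul_of_nonneg_left (by linarith) hb2.le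
  refine lt_of_lt_of_le ?_ hlow
  rcases le_total (7 / 2 * b) c with h | h
  · have h1 : 5 / 7 * c ≤ c - b := by linarith
    have h2 : t * (2 * c) * (5 / 7 * c) ≤ t * (a + 2 * c) * (c - b) := by
      apply mul_le_mul _ h1 (by positivity) (by positivity)
      exact mul_le_mul_of_nonneg_left (by linarith) ht.le
    have h3 : (b + c) ^ 2 ≤ (9 / 7 * c) ^ 2 := pow_le_pow_left₀ (by positivity) (by linarith) 2
    have h4 := mul_le_mul_of_nonneg_left h3 ht.le
    have h5 : 0 < b * c := by positivity
    have h6 : t * (b + c) ^ 2 ≤ 81 / 35 * ((n - 2 * t) * b ^ 2) := by nlinarith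
    refine lt_of_le_of_lt h6 ?_
    have : b ^ 2 * (81 / 35 * (n - 2 * t)) < b ^ 2 * (22 / 7 * n - 2 * t - 2) :=
      mul_lt_mul_of_pos_left (by linarith) hb2
    linarith
  · have h3 : (b + c) ^ 2 ≤ (9 / 2 * b) ^ 2 := pow_le_pow_left₀ (by positivity) (by linarith) 2
    have h4 := mul_le_mul_of_nonneg_left h3 ht.le
    have : b ^ 2 * (81 / 4 * t) < b ^ 2 * (22 / 7 * n - 2 * t - 2) :=
      mul_lt_mul_of_pos_left (by linarith) hb2
    linarith

variable {V : Type*} [Fintype V] [DecidableEq V]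

theorem sum_three_values {V : Type*} [DecidableEq V] (A B C : Finset V) (hBC : Disjoint B C) (a b c : ℝ) (g : ℝ → ℝ) :
    ∑ v ∈ A, g (if v ∈ C then c else if v ∈ B then a else b)
      = A.card * g b + (A ∩ C).card * (g c - g b) + (A ∩ B).card * (g a - g b) := by
  have : ∀ v, g (if v ∈ C then c else if v ∈ B then a else b)
      = g b + (if v ∈ C then g c - g b else 0) + (if v ∈ B then g a - g b else 0) := by
    intro v
    by_cases h1 : v ∈ C
    · have h2 : v ∉ B := fun h => Finset.disjoint_left.1 hBC h h1
      simp [h1, h2]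
    · by_cases h2 : v ∈ B <;> simp [h1, h2]
  simp only [this, Finset.sum_add_distrib, Finset.sum_const, Finset.sum_ite_mem, nsmul_eq_mul]

/-- If `I` has at most `|S|` neighbours, all of them in `S`, then a small distance signless
Laplacian spectral radius forces `G` to be the extremal graph. -/
theorem adj_of_radius_le_radius_extremalGraph (G : SimpleGraph V) (hG : G.Connected) {n t : ℕ}
    (hcard : Fintype.card V = n) (ht : 1 ≤ t) (hn : 9 * t + 3 ≤ n)
    (hη : distanceSignlessLaplacianRadius G ≤
      distanceSignlessLaplacianRadius (extremalGraph n t))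
    {I S : Finset V} (hIS : Disjoint I S) (hcs : I.card = S.card) (hts : t ≤ I.card)
    (hadj : ∀ u ∈ I, ∀ v, G.Adj u v → v ∈ S) :
    I.card = t ∧ ∀ u v, u ≠ v → (u ∈ I → v ∈ S) → (v ∈ I → u ∈ S) → G.Adj u v := by
  set R := (I ∪ S)ᶜ with hR
  have hIR : Disjoint I R := Finset.disjoint_left.2 fun v h1 h2 => by simp [hR, h1] at h2
  have hSR : Disjoint S R := Finset.disjoint_left.2 fun v h1 h2 => by simp [hR, h1] at h2
  have hRc : R.card + 2 * I.card = n := by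
    have h1 := Finset.card_add_card_compl (I ∪ S)
    rw [Finset.card_union_of_disjoint hIS, ← hR] at h1
    omega
  have hnon : ∀ u ∈ I, ∀ v, v ∈ I ∨ v ∈ R → ¬ G.Adj u v := by
    intro u hu v hv h
    have h1 := hadj u hu v h
    rcases hv with hv | hv
    · exact Finset.disjoint_left.1 hIS hv h1
    · exact Finset.disjoint_left.1 hSR h1 hv
  obtain ⟨It, hIt, hItc⟩ := Finset.exists_subset_card_eq hts
  obtain ⟨St, hSt, hStc⟩ := Finset.exists_subset_card_eq (hcs ▸ hts : t ≤ S.card)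
  have hdisj : Disjoint St It := (Finset.disjoint_of_subset_left hIt
    (Finset.disjoint_of_subset_right hSt hIS)).symm
  obtain ⟨a, b, c, ha, hb, hc, ea, eb, ec⟩ :=
    exists_extremalGraph_quotient_eigenvector ht (by omega : 2 * t < n)
  have hbound := radius_extremalGraph_le ht hn
  set l := distanceSignlessLaplacianRadius (extremalGraph n t) with hl
  have ht' : (1 : ℝ) ≤ t := by exact_mod_cast ht
  have hn' : (9 : ℝ) * t + 3 ≤ n := by exact_mod_cast hn
  have hts' : (t : ℝ) ≤ I.card := by exact_mod_cast hts
  have hRc' : (R.card : ℝ) = n - 2 * I.card := by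
    have : (R.card : ℝ) + 2 * I.card = n := by exact_mod_cast hRc
    linarith
  have hR0 : (0 : ℝ) ≤ R.card := Nat.cast_nonneg _
  set s : ℝ := (I.card : ℝ) with hs
  have e1 : I ∩ It = It := Finset.inter_eq_right.2 hIt
  have e2 : I ∩ St = ∅ := Finset.disjoint_iff_inter_eq_empty.1
    (Finset.disjoint_of_subset_right hSt hIS)
  have e3 : R ∩ It = ∅ := Finset.disjoint_iff_inter_eq_empty.1
    (Finset.disjoint_of_subset_right hIt hIR.symm)
  have e4 : R ∩ St = ∅ := Finset.disjoint_iff_inter_eq_empty.1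
    (Finset.disjoint_of_subset_right hSt hSR.symm)
  -- The Perron vector of the extremal graph, transplanted along `It ⊆ I` and `St ⊆ S`; surplus
  -- vertices of `I` and `S` get the clique value `b`.
  set x : V → ℝ := fun v => if v ∈ It then c else if v ∈ St then a else b with hx
  have hxpos : ∀ v, 0 < x v := by
    intro v
    simp only [hx]
    split_ifs <;> assumption
  have sU := fun g => sum_three_values Finset.univ St It hdisj a b c g
  have sI := fun g => sum_three_values I St It hdisj a b c g
  have sR := fun g => sum_three_values R St It hdisj a b c g
  simp only [Finset.univ_inter, e1, e2, e3, e4, hItc, hStc, Finset.card_empty, Nat.cast_zero,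
    zero_mul, add_zero, Finset.card_univ, hcard, ← hs, hRc'] at sU sI sR
  have hxx : x ⬝ᵥ x = ∑ v, x v ^ 2 := by simp [dotProduct, sq]
  have hform : joinForm I R x = l * (x ⬝ᵥ x)
      + (s - t) * (b ^ 2 * (4 * n - 2 * t - 6 * s - 2) - t * (b + c) ^ 2) := by
    rw [hxx, joinForm, sU (fun z => z ^ 2), sU (fun z => z), sI (fun z => z ^ 2),
      sI (fun z => z), sR (fun z => z ^ 2), sR (fun z => z), hcard, ← hs, hRc']
    linear_combination (-(t : ℝ) * a) * ea - (n - 2 * t : ℝ) * b * eb - (t : ℝ) * c * ec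
  have hxx0 : 0 ≤ x ⬝ᵥ x := by rw [hxx]; positivity
  have hup := (dotProduct_mulVec_le_radius G x).trans (mul_le_mul_of_nonneg_right hη hxx0)
  have hlow := joinForm_le_dotProduct_mulVec G hG I R hIR hnon x
  have hst : I.card = t := by
    by_contra hne
    have hlt : (t : ℝ) < s := lt_of_le_of_ne hts' fun h => hne (Nat.cast_injective (R := ℝ) h.symm)
    rcases le_total (7 * s) n with h7 | h7
    · have := mul_add_sq_lt_of_quotient_eigenvector (by linarith) hn' h7 ha hb hc eb ec
      have := mul_pos (sub_pos.2 hlt) (sub_pos.2 this)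
      linarith
    -- For large `s` the Perron vector is not used: the values 5 on `I` and 2 elsewhere already beat
    -- the explicit bound `(8n - 12)/3`. The surplus is controlled by `(7s - n)(n - 2s) ≥ 0`.
    · set z : V → ℝ := fun v => if v ∈ I then 5 else if v ∈ (∅ : Finset V) then 2 else 2 with hz
      have zU := fun g => sum_three_values Finset.univ ∅ I (Finset.disjoint_empty_left _) 2 2 5 g
      have zI := fun g => sum_three_values I ∅ I (Finset.disjoint_empty_left _) 2 2 5 g
      have zR := fun g => sum_three_values R ∅ I (Finset.disjoint_empty_left _) 2 2 5 g
      simp only [Finset.univ_inter, Finset.inter_self, Finset.inter_empty,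
        Finset.disjoint_iff_inter_eq_empty.1 hIR.symm, Finset.card_empty, Nat.cast_zero,
        zero_mul, add_zero, Finset.card_univ, hcard, ← hs, hRc'] at zU zI zR
      have hzz : z ⬝ᵥ z = ∑ v, z v ^ 2 := by simp [dotProduct, sq]
      have hzv : z ⬝ᵥ z = 4 * n + 21 * s := by
        rw [hzz, zU (fun z => z ^ 2)]; ring
      have hzform : joinForm I R z = (8 * n - 12) / 3 * (4 * n + 21 * s)
          + (-(8 / 3) * n ^ 2 + 26 * n * s - 39 * s ^ 2 + 8 * n - 8 * s) := by
        rw [joinForm, zU (fun z => z ^ 2), zU (fun z => z), zI (fun z => z ^ 2),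
          zI (fun z => z), zR (fun z => z ^ 2), zR (fun z => z), hcard, ← hs, hRc']
        ring
      have h1 := joinForm_le_dotProduct_mulVec G hG I R hIR hnon z
      have h2 := dotProduct_mulVec_le_radius G z
      rw [hzv] at h2
      have h3 := mul_le_mul_of_nonneg_right (hη.trans hbound)
        (by linarith : (0 : ℝ) ≤ 4 * n + 21 * s)
      have h4 : 0 ≤ (7 * s - n) * (n - 2 * s) :=
        mul_nonneg (by linarith) (by linarith)
      have h5 : 0 < n * s := mul_pos (by linarith) (by linarith)
      nlinarith
  refine ⟨hst, fun u v huv h1 h2 => ?_⟩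
  by_contra hna
  -- With `s = t` the form equals `l` times the squared norm of `x`, so one missing edge would push
  -- the radius of `G` above `l`.
  have hlt := joinForm_lt_dotProduct_mulVec G hG I R hIR hnon hxpos huv hna (by
    rintro (⟨hu, hv⟩ | ⟨hu, hv⟩ | ⟨hv, hu⟩)
    · exact Finset.disjoint_left.1 hIS hv (h1 hu)
    · exact Finset.disjoint_left.1 hSR (h1 hu) hv
    · exact Finset.disjoint_left.1 hSR (h2 hv) hu)
  have hst' : s = t := by rw [hs, hst]
  rw [hform, hst', sub_self, zero_mul, add_zero] at hlt
  linarith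

end Comparison

/-! ### Linkages and the edge exchange -/

section Exchange

/-- The graph whose edges are the pairs `{v, τ v}`. -/
def permGraph {V : Type*} (τ : Equiv.Perm V) : SimpleGraph V :=
  SimpleGraph.fromRel fun u v => τ u = v

theorem permGraph_adj {V : Type*} {τ : Equiv.Perm V} {u v : V} :
    (permGraph τ).Adj u v ↔ u ≠ v ∧ (τ u = v ∨ τ v = u) := by
  simp [permGraph]

theorem permGraph_adj_iff_of_involutive {V : Type*} {τ : Equiv.Perm V} {u v : V}
    (hu : τ (τ u) = u) : (permGraph τ).Adj u v ↔ u ≠ v ∧ v = τ u := by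
  rw [permGraph_adj]
  constructor
  · rintro ⟨h, h' | h'⟩
    · exact ⟨h, h'.symm⟩
    · exact ⟨h, τ.injective (by rw [h', hu])⟩
  · rintro ⟨h, h'⟩
    exact ⟨h, Or.inl h'.symm⟩

theorem SimpleGraph.Connected.of_adj_reachable {V : Type*} {H H' : SimpleGraph V}
    (hH : H.Connected) (h : ∀ p q, H.Adj p q → H'.Reachable p q) : H'.Connected := by
  have := hH.nonempty
  refine ⟨fun u v => ?_⟩
  obtain ⟨w⟩ := hH.preconnected u v
  induction w with
  | nil => exact Reachable.rfl
  | cons hadj _ ih => exact (h _ _ hadj).trans ih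

variable {V : Type*}

/-- Replace the edge `vb` by the edge `xz`. -/
def exchangeEdge (H : SimpleGraph V) (v b x z : V) : SimpleGraph V :=
  H.deleteEdges {s(v, b)} ⊔ SimpleGraph.edge x z

theorem exchangeEdge_adj {H : SimpleGraph V} {v b x z p q : V} (hxz : x ≠ z) :
    (exchangeEdge H v b x z).Adj p q ↔
      (H.Adj p q ∧ ¬ (p = v ∧ q = b) ∧ ¬ (p = b ∧ q = v)) ∨ (p = x ∧ q = z) ∨ (p = z ∧ q = x) := by
  simp only [exchangeEdge, sup_adj, deleteEdges_adj, Set.mem_singleton_iff, Sym2.eq_iff, edge_adj]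
  constructor
  · rintro (⟨h, h'⟩ | ⟨h, h'⟩)
    · left; tauto
    · right; tauto
  · rintro (⟨h, h'⟩ | ⟨rfl, rfl⟩ | ⟨rfl, rfl⟩)
    · left; tauto
    · right; tauto
    · right; exact ⟨by tauto, hxz.symm⟩

/-- One walk misses `b` and the other misses `v`, so neither uses the deleted edge; together with
`xz` they reconnect `v` to `b`. -/
theorem exchangeEdge_connected {H : SimpleGraph V} (hH : H.Connected) {v b x z : V} (hxz : x ≠ z)
    (p : H.Walk x v) (hp : b ∉ p.support) (q : H.Walk b z) (hq : v ∉ q.support) :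
    (exchangeEdge H v b x z).Connected := by
  have hadj : ∀ {c d}, H.Adj c d → s(c, d) ≠ s(v, b) → (exchangeEdge H v b x z).Adj c d := by
    intro c d h h'
    rw [exchangeEdge_adj hxz]
    left
    refine ⟨h, ?_, ?_⟩ <;> rintro ⟨rfl, rfl⟩ <;> simp at h'
  have hp' : (exchangeEdge H v b x z).Reachable x v := by
    refine ⟨p.transfer _ fun e he => ?_⟩
    induction e with
    | h c d =>
      refine hadj (p.adj_of_mem_edges he) ?_
      intro h
      rw [h] at he
      exact hp (p.snd_mem_support_of_mem_edges he)
  have hq' : (exchangeEdge H v b x z).Reachable b z := by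
    refine ⟨q.transfer _ fun e he => ?_⟩
    induction e with
    | h c d =>
      refine hadj (q.adj_of_mem_edges he) ?_
      intro h
      rw [h] at he
      exact hq (q.fst_mem_support_of_mem_edges he)
  have hxz' : (exchangeEdge H v b x z).Adj x z := by
    rw [exchangeEdge_adj hxz]; tauto
  have hvb : (exchangeEdge H v b x z).Reachable v b :=
    hp'.symm.trans (hxz'.reachable.trans hq'.symm)
  refine hH.of_adj_reachable fun c d h => ?_
  by_cases hcd : s(c, d) = s(v, b)
  · rw [Sym2.eq_iff] at hcd
    rcases hcd with ⟨rfl, rfl⟩ | ⟨rfl, rfl⟩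
    · exact hvb
    · exact hvb.symm
  · exact (hadj h hcd).reachable

theorem exchangeEdge_edgeSet_ncard [Finite V] {H : SimpleGraph V} {v b x z : V}
    (hxz : x ≠ z) (h : H.Adj v b) (hn : ¬ H.Adj x z) :
    (exchangeEdge H v b x z).edgeSet.ncard = H.edgeSet.ncard := by
  have : (exchangeEdge H v b x z).edgeSet = insert s(x, z) (H.edgeSet \ {s(v, b)}) := by
    ext e
    induction e with
    | h c d =>
      rw [mem_edgeSet, exchangeEdge_adj hxz]
      simp only [Set.mem_insert_iff, Set.mem_sdiff, mem_edgeSet, Set.mem_singleton_iff, Sym2.eq_iff]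
      tauto
  rw [this]
  exact Set.ncard_exchange hn h

/-- The number of neighbours of a vertex. -/
noncomputable def deg (H : SimpleGraph V) (v : V) : ℕ := (H.neighborSet v).ncard

section Degrees

variable [Finite V] {H : SimpleGraph V} {v b x z : V}

theorem deg_pos_of_adj (h : H.Adj v b) : 0 < deg H v :=
  (Set.ncard_pos (Set.toFinite _)).2 ⟨b, h⟩

theorem exchangeEdge_deg_of_ne {V : Type*} {H : SimpleGraph V} {v b x z : V} (hxz : x ≠ z) {y : V} (h1 : y ≠ v) (h2 : y ≠ b) (h3 : y ≠ x)
    (h4 : y ≠ z) : deg (exchangeEdge H v b x z) y = deg H y := by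
  unfold deg
  congr 1
  ext w
  simp only [mem_neighborSet, exchangeEdge_adj hxz]
  tauto

theorem exchangeEdge_deg_fst (hxz : x ≠ z) (hn : ¬ H.Adj x z) (hv : x ≠ v) (hb : x ≠ b) :
    deg (exchangeEdge H v b x z) x = deg H x + 1 := by
  unfold deg
  rw [← Set.ncard_insert_of_notMem (s := H.neighborSet x) (a := z) hn]
  congr 1
  ext w
  simp only [mem_neighborSet, exchangeEdge_adj hxz, Set.mem_insert_iff]
  tauto

theorem exchangeEdge_deg_snd (hxz : x ≠ z) (hn : ¬ H.Adj x z) (hv : z ≠ v) (hb : z ≠ b) :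
    deg (exchangeEdge H v b x z) z = deg H z + 1 := by
  unfold deg
  rw [← Set.ncard_insert_of_notMem (s := H.neighborSet z) (a := x) (fun h => hn h.symm)]
  congr 1
  ext w
  simp only [mem_neighborSet, exchangeEdge_adj hxz, Set.mem_insert_iff]
  tauto

theorem exchangeEdge_deg_left (hxz : x ≠ z) (h : H.Adj v b) (hx : v ≠ x) (hz : v ≠ z) :
    deg (exchangeEdge H v b x z) v + 1 = deg H v := by
  unfold deg
  rw [← Set.ncard_sdiff_singleton_add_one (s := H.neighborSet v) (a := b) h]
  congr 2
  ext w
  have := h.ne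
  simp only [mem_neighborSet, exchangeEdge_adj hxz, Set.mem_sdiff, Set.mem_singleton_iff]
  tauto

theorem exchangeEdge_deg_right (hxz : x ≠ z) (h : H.Adj v b) (hx : b ≠ x) (hz : b ≠ z) :
    deg (exchangeEdge H v b x z) b + 1 = deg H b := by
  unfold deg
  rw [← Set.ncard_sdiff_singleton_add_one (s := H.neighborSet b) (a := v) h.symm]
  congr 2
  ext w
  have := h.ne
  simp only [mem_neighborSet, exchangeEdge_adj hxz, Set.mem_sdiff, Set.mem_singleton_iff]
  tauto

theorem exchangeEdge_deg_snd_eq {V : Type*} {H : SimpleGraph V} {v x z : V} (hxz : x ≠ z) (hn : ¬ H.Adj x z) (h : H.Adj v z) : deg (exchangeEdge H v z x z) z = deg H z := by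
  unfold deg
  rw [← Set.ncard_exchange (s := H.neighborSet z) (a := x) (b := v) (fun h => hn h.symm) h.symm]
  congr 1
  ext w
  have := h.ne
  simp only [mem_neighborSet, exchangeEdge_adj hxz, Set.mem_insert_iff, Set.mem_sdiff,
    Set.mem_singleton_iff]
  tauto

end Degrees

/-- The leaves of `H` whose partner under the involution has degree at least three. -/
def badLeaves (τ : Equiv.Perm V) (H : SimpleGraph V) : Set V :=
  {y | τ (τ y) = y ∧ deg H y = 1 ∧ 3 ≤ deg H (τ y)}

/-- Connected spanning subgraphs of `G` containing all pairs `{v, τ v}`. -/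
def IsLinkage (τ : Equiv.Perm V) (G H : SimpleGraph V) : Prop :=
  permGraph τ ≤ H ∧ H ≤ G ∧ H.Connected

/-- Lexicographic cost: number of edges, then number of bad leaves. -/
noncomputable def linkageCost (τ : Equiv.Perm V) (H : SimpleGraph V) : ℕ :=
  H.edgeSet.ncard * (Nat.card V + 1) + (badLeaves τ H).ncard

/-- Linkages of minimum cost. -/
def IsOptimalLinkage (τ : Equiv.Perm V) (G H : SimpleGraph V) : Prop :=
  IsLinkage τ G H ∧ ∀ H', IsLinkage τ G H' → linkageCost τ H ≤ linkageCost τ H'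

variable {τ : Equiv.Perm V} {G H : SimpleGraph V}

theorem exists_isOptimalLinkage (hG : G.Connected) (hτ : permGraph τ ≤ G) :
    ∃ H, IsOptimalLinkage τ G H := by
  obtain ⟨H, hH, hmin⟩ := (measure (linkageCost τ)).wf.has_min {H | IsLinkage τ G H}
    ⟨G, hτ, le_rfl, hG⟩
  exact ⟨H, hH, fun H' h => not_lt.1 (hmin H' h)⟩

variable [Finite V]

/-- Degrees change only at `v`, `b` (down) and `x`, `z` (up), cancelling when `b = z`. Now `x` has
degree two and `v` at least two. A new bad leaf is therefore `b`, dropping to degree one, or the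
partner of `z`, whose degree rose. -/
theorem mem_badLeaves_of_exchangeEdge (hτ : permGraph τ ≤ H) (hne : ∀ y, τ y ≠ y) {v b x z y : V}
    (hx : x ∈ badLeaves τ H)
    (hv : 3 ≤ deg H v) (h : H.Adj v b) (hbx : b ≠ x) (hvx : v ≠ x) (hxz : x ≠ z)
    (hn : ¬ H.Adj x z) (hvz : v ≠ z) (hy : y ∈ badLeaves τ (exchangeEdge H v b x z)) :
    y ≠ x ∧ (y ∈ badLeaves τ H ∨ (y = b ∧ b ≠ z ∧ deg H y = 2) ∨
      (y = τ z ∧ b ≠ z ∧ deg H y = 1)) := by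
  obtain ⟨hyK, hy1, hy3⟩ := hy
  have hxdeg := exchangeEdge_deg_fst hxz hn hvx.symm hbx.symm
  have hvdeg := exchangeEdge_deg_left hxz h hvx hvz
  have hx1 := hx.2.1
  have hpos : ∀ w, 0 < deg H w := fun w =>
    deg_pos_of_adj (hτ (permGraph_adj.2 ⟨(hne w).symm, Or.inl rfl⟩))
  have hyx : y ≠ x := by rintro rfl; omega
  have hyv : y ≠ v := by rintro rfl; omega
  have hτx : τ y ≠ x := by intro h'; rw [h'] at hy3; omega
  refine ⟨hyx, ?_⟩
  have htau : b = z → 3 ≤ deg H (τ y) := by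
    rintro rfl
    by_cases h1 : τ y = v
    · rw [h1]; exact hv
    · by_cases h2 : τ y = b
      · rw [h2] at hy3 ⊢
        rwa [exchangeEdge_deg_snd_eq hxz hn h] at hy3
      · rwa [exchangeEdge_deg_of_ne hxz h1 h2 hτx h2] at hy3
  by_cases hyb : y = b
  · by_cases hbz : b = z
    · left
      refine ⟨hyK, ?_, htau hbz⟩
      subst hbz
      subst hyb
      rwa [exchangeEdge_deg_snd_eq hxz hn h] at hy1
    · right; left
      refine ⟨hyb, hbz, ?_⟩
      have := exchangeEdge_deg_right hxz h hbx hbz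
      rw [hyb] at hy1 ⊢
      omega
  · have hyz : y ≠ z := by
      rintro rfl
      rw [exchangeEdge_deg_snd hxz hn hyv hyb] at hy1
      have := hpos y
      omega
    rw [exchangeEdge_deg_of_ne hxz hyv hyb hyx hyz] at hy1
    by_cases h3 : 3 ≤ deg H (τ y)
    · exact Or.inl ⟨hyK, hy1, h3⟩
    · right; right
      have hbz : b ≠ z := fun h' => h3 (htau h')
      refine ⟨?_, hbz, hy1⟩
      by_contra hyz'
      have h1 : τ y ≠ v := by rintro h'; rw [h'] at h3; exact h3 hv
      have h2 : τ y ≠ z := by rintro h'; rw [← h', hyK] at hyz'; exact hyz' rfl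
      by_cases h4 : τ y = b
      · have := exchangeEdge_deg_right hxz h hbx hbz
        rw [h4] at hy3 h3
        omega
      · rw [exchangeEdge_deg_of_ne hxz h1 h4 hτx h2] at hy3
        exact h3 hy3

/-- The key exchange argument along a path. -/
theorem exists_optimal_of_path (hne : ∀ y, τ y ≠ y) (hH : IsOptimalLinkage τ G H) {x z : V}
    (hx : x ∈ badLeaves τ H) (hxz : G.Adj x z) (hn : ¬ H.Adj x z) :
    ∀ (k : ℕ) (v : V) (p : H.Walk x v) (q : H.Walk v z), q.length ≤ k → (p.append q).IsPath →
      v ≠ x → v ≠ z → τ (τ v) = v → 3 ≤ deg H v → τ v ∈ p.support →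
      τ (τ z) = z ∧ (∃ H', IsOptimalLinkage τ G H' ∧ τ z ∈ badLeaves τ H') ∧
        (deg H (τ z) = 1 ∨ (τ z ∈ (p.append q).support ∧ 2 ≤ deg H z)) := by
  intro k
  induction k with
  | zero =>
    intro v p q hq _ _ hvz
    exact absurd (Walk.eq_of_length_eq_zero (Nat.le_zero.1 hq)) hvz
  | succ k ih =>
    intro v p q hq hpath hvx hvz hvK hv3 hτv
    cases q with
    | nil => exact absurd rfl hvz
    | @cons _ b _ h r =>
    obtain ⟨⟨hF, hHG, hHc⟩, hmin⟩ := hH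
    have hnodup := hpath.support_nodup
    rw [Walk.support_append, Walk.support_cons, List.tail_cons, List.nodup_append] at hnodup
    obtain ⟨hpn, hrn, hpr⟩ := hnodup
    have hbp : b ∉ p.support := fun h' => hpr b h' b r.start_mem_support rfl
    have hvr : v ∉ r.support := fun h' => hpr v p.end_mem_support v h' rfl
    have hxr : x ∉ r.support := fun h' => hpr x p.start_mem_support x h' rfl
    have hbx : b ≠ x := by rintro rfl; exact hbp p.start_mem_support
    have hxz' := hxz.ne
    -- The partner of `v` lies behind it on the path, so the edge to `b` is not a `τ`-edge and may
    -- be deleted.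
    have hbF : ¬ (permGraph τ).Adj v b := by
      rw [permGraph_adj_iff_of_involutive hvK]
      rintro ⟨-, rfl⟩
      exact hbp hτv
    set H' := exchangeEdge H v b x z with hH'
    have hlink : IsLinkage τ G H' := by
      refine ⟨fun c d hcd => ?_, fun c d hcd => ?_, exchangeEdge_connected hHc hxz' p hbp r hvr⟩
      · rw [hH', exchangeEdge_adj hxz']
        refine Or.inl ⟨hF hcd, ?_, ?_⟩
        · rintro ⟨rfl, rfl⟩; exact hbF hcd
        · rintro ⟨rfl, rfl⟩; exact hbF hcd.symm
      · rw [hH', exchangeEdge_adj hxz'] at hcd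
        rcases hcd with ⟨hcd, -⟩ | ⟨rfl, rfl⟩ | ⟨rfl, rfl⟩
        · exact hHG hcd
        · exact hxz
        · exact hxz.symm
    have hedges : H'.edgeSet.ncard = H.edgeSet.ncard := exchangeEdge_edgeSet_ncard hxz' h hn
    have hcard : (badLeaves τ H).ncard ≤ (badLeaves τ H').ncard := by
      have := hmin H' hlink
      simp only [linkageCost, hedges] at this
      omega
    have hopt : (badLeaves τ H').ncard ≤ (badLeaves τ H).ncard → IsOptimalLinkage τ G H' := by
      intro h'
      refine ⟨hlink, fun H'' h'' => le_trans ?_ (hmin H'' h'')⟩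
      simp only [linkageCost, hedges]
      omega
    have hnew := fun y (hy : y ∈ badLeaves τ H') =>
      mem_badLeaves_of_exchangeEdge hF hne hx hv3 h hbx hvx hxz' hn hvz hy
    -- The exchange cures `x`, so by optimality a new bad leaf must appear. If only one vertex is
    -- new, the cost is unchanged and `H'` is optimal too.
    have hnotsub : ¬ badLeaves τ H' ⊆ badLeaves τ H \ {x} := by
      intro hsub
      have h1 := Set.ncard_le_ncard hsub (Set.toFinite _)
      have h2 := Set.ncard_sdiff_singleton_lt_of_mem hx (Set.toFinite _)
      omega
    have hins : ∀ w, badLeaves τ H' ⊆ insert w (badLeaves τ H \ {x}) →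
        IsOptimalLinkage τ G H' := by
      intro w hsub
      apply hopt
      have h1 := Set.ncard_le_ncard hsub (Set.toFinite _)
      have h2 := Set.ncard_insert_le w (badLeaves τ H \ {x})
      have h3 := Set.ncard_sdiff_singleton_add_one hx (Set.toFinite _)
      omega
    by_cases hbad : b ∈ badLeaves τ H' ∧ b ∉ badLeaves τ H
    · obtain ⟨hb', hbH⟩ := hbad
      obtain ⟨-, hb⟩ := hnew b hb'
      have hbz : b ≠ z := by tauto
      obtain ⟨hbK, hb1, hb3⟩ := hb'
      have hb2 : deg H b = 2 := by
        have := exchangeEdge_deg_right hxz' h hbx hbz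
        rw [← hH'] at this
        omega
      have hτbv : τ b ≠ v := fun h' => hbF (permGraph_adj.2 ⟨h.ne, Or.inr h'⟩)
      have hbτ : H.Adj b (τ b) := hF (permGraph_adj.2 ⟨(hne b).symm, Or.inl rfl⟩)
      -- If `b` turns bad, it had degree two with neighbours `v` and `τ b`, so the path continues to
      -- `c = τ b`. Either `c = z`, or `c` has degree at least three with its partner `b` behind it,
      -- and the induction restarts from `c` in the original `H`.
      have hNb : H.neighborSet b = {v, τ b} := by
        refine (Set.eq_of_subset_of_ncard_le ?_ ?_ (Set.toFinite _)).symm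
        · rintro w (rfl | rfl)
          · exact h.symm
          · exact hbτ
        · rw [Set.ncard_pair hτbv.symm]; exact hb2.le
      cases r with
      | nil => exact absurd rfl hbz
      | @cons _ c _ h' r' =>
      have hcv : c ≠ v := by
        rintro rfl
        exact hvr (by simp)
      have hc : c = τ b := by
        have : c ∈ H.neighborSet b := h'
        rw [hNb] at this
        rcases this with h'' | h''
        · exact absurd h'' hcv
        · exact h''
      have hcx : c ≠ x := by
        rintro rfl
        exact hxr (by simp)
      by_cases hcz : c = z
      · have hτz : τ z = b := by rw [← hcz, hc, hbK]
        refine ⟨by rw [hτz, ← hc, hcz], ⟨H', hins b ?_, by rw [hτz]; exact ⟨hbK, hb1, hb3⟩⟩,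
          Or.inr ⟨?_, ?_⟩⟩
        · intro y hy
          obtain ⟨hyx, hy | hy | hy⟩ := hnew y hy
          · exact Or.inr ⟨hy, hyx⟩
          · exact Or.inl hy.1
          · exact Or.inl (hy.1.trans hτz)
        · rw [hτz]; simp
        · rw [← hc, hcz, hH', exchangeEdge_deg_snd hxz' hn hvz.symm hbz.symm] at hb3
          omega
      · have hdc : 3 ≤ deg H c := by
          rw [← hc, hH', exchangeEdge_deg_of_ne hxz' hcv h'.ne' hcx hcz] at hb3
          exact hb3
        have happ : (p.append (Walk.cons h (Walk.cons h' Walk.nil))).append r'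
            = p.append (Walk.cons h (Walk.cons h' r')) := by
          rw [← Walk.append_assoc, Walk.cons_append, Walk.cons_append, Walk.nil_append]
        have := ih c (p.append (Walk.cons h (Walk.cons h' Walk.nil))) r'
          (by simp only [Walk.length_cons] at hq; omega) (by rw [happ]; exact hpath) hcx hcz
          (by rw [hc, hbK]) hdc (by
            have hcb : τ c = b := by rw [hc, hbK]
            rw [hcb]; simp)
        rw [happ] at this
        exact this
    -- If `b` is not newly bad, the only candidate for the new bad leaf is `τ z`.
    · have hnew' : ∀ y ∈ badLeaves τ H', y ∈ badLeaves τ H \ {x} ∨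
          (y = τ z ∧ deg H y = 1) := by
        intro y hy
        obtain ⟨hyx, h1 | h1 | h1⟩ := hnew y hy
        · exact Or.inl ⟨h1, hyx⟩
        · left
          refine ⟨?_, hyx⟩
          rw [h1.1] at hy ⊢
          by_contra h2
          exact hbad ⟨hy, h2⟩
        · exact Or.inr ⟨h1.1, h1.2.2⟩
      obtain ⟨y, hy, hyn⟩ := Set.not_subset.1 hnotsub
      obtain h1 | ⟨rfl, hy1⟩ := hnew' y hy
      · exact absurd h1 hyn
      · refine ⟨τ.injective hy.1, ⟨H', hins (τ z) ?_, hy⟩, Or.inl hy1⟩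
        intro w hw
        rcases hnew' w hw with h2 | h2
        · exact Or.inr h2
        · exact Or.inl h2.1

end Exchange

/-! ### An optimal linkage without bad leaves -/

section GoodLinkage

theorem SimpleGraph.Connected.mem_of_closed {V : Type*} {H : SimpleGraph V} (hH : H.Connected)
    {A : Set V} {a : V} (ha : a ∈ A) (hA : ∀ u ∈ A, ∀ v, H.Adj u v → v ∈ A) (v : V) : v ∈ A := by
  obtain ⟨w⟩ := hH.preconnected a v
  induction w with
  | nil => exact ha
  | cons h _ ih => exact ih (hA _ ha _ h)

variable {V : Type*} {τ : Equiv.Perm V} {G H : SimpleGraph V}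

theorem eq_of_deg_eq_one {x y z : V} (h : deg H x = 1) (hy : H.Adj x y) (hz : H.Adj x z) :
    y = z := by
  obtain ⟨w, hw⟩ := Set.ncard_eq_one.1 h
  have h1 : y ∈ H.neighborSet x := hy
  have h2 : z ∈ H.neighborSet x := hz
  rw [hw] at h1 h2
  exact h1.trans h2.symm

theorem IsLinkage.adj (h : IsLinkage τ G H) (hne : ∀ y, τ y ≠ y) (y : V) : H.Adj y (τ y) :=
  h.1 (permGraph_adj.2 ⟨(hne y).symm, Or.inl rfl⟩)

variable [Finite V]

/-- A path leaving the leaf `x` begins with the edge to `τ x`, which has degree at least three; the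
exchange starts there. -/
theorem IsOptimalLinkage.neighbor_of_badLeaf (hne : ∀ y, τ y ≠ y) (hH : IsOptimalLinkage τ G H)
    {x z : V} (hx : x ∈ badLeaves τ H) (hxz : G.Adj x z) (hz : z ≠ τ x) (p : H.Walk x z)
    (hp : p.IsPath) :
    τ (τ z) = z ∧ (∃ H', IsOptimalLinkage τ G H' ∧ τ z ∈ badLeaves τ H') ∧
      (deg H (τ z) = 1 ∨ (τ z ∈ p.support ∧ 2 ≤ deg H z)) := by
  have hxτ := hH.1.adj hne x
  have hn : ¬ H.Adj x z := fun h => hz (eq_of_deg_eq_one hx.2.1 h hxτ)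
  cases p with
  | nil => exact absurd rfl hxz.ne
  | @cons _ w _ h q =>
    obtain rfl : w = τ x := eq_of_deg_eq_one hx.2.1 h hxτ
    have := exists_optimal_of_path hne hH hx hxz hn q.length (τ x) (Walk.cons h Walk.nil) q le_rfl
      (by rwa [Walk.cons_append, Walk.nil_append]) (hne x) (Ne.symm hz) (by rw [hx.1]) hx.2.2
      (by rw [hx.1]; simp)
    rwa [Walk.cons_append, Walk.nil_append] at this

/-- Apply the exchange towards both `z` and `τ z`. If both have degree one, `{z, τ z}` is a whole
component. Otherwise `τ z` precedes `z` on a path from `x`, and the part of that path up to `τ z`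
would have to contain `z`. -/
theorem IsOptimalLinkage.not_adj_of_adj (hne : ∀ y, τ y ≠ y) (hH : IsOptimalLinkage τ G H)
    {x z : V} (hx : x ∈ badLeaves τ H) (hxz : G.Adj x z) (hz : z ≠ τ x) : ¬ G.Adj x (τ z) := by
  classical
  intro hxz'
  have hc := hH.1.2.2
  obtain ⟨p, hp⟩ := hc.exists_isPath x z
  obtain ⟨hzK, -, h⟩ := hH.neighbor_of_badLeaf hne hx hxz hz p hp
  have hz' : τ z ≠ τ x := fun h' => hxz.ne (τ.injective h').symm
  rcases h with h | ⟨hmem, h2⟩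
  · obtain ⟨q, hq⟩ := hc.exists_isPath x (τ z)
    obtain ⟨-, -, h'⟩ := hH.neighbor_of_badLeaf hne hx hxz' hz' q hq
    rw [hzK] at h'
    have h1 : deg H z = 1 := by
      rcases h' with h' | ⟨-, h'⟩
      · exact h'
      · omega
    have hzz := hH.1.adj hne z
    have := hc.mem_of_closed (A := {z, τ z}) (a := z) (Or.inl rfl) (by
      rintro u (rfl | rfl) v huv
      · exact Or.inr (eq_of_deg_eq_one h1 huv hzz)
      · exact Or.inl (eq_of_deg_eq_one h huv hzz.symm)) x
    rcases this with rfl | rfl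
    · exact hxz.ne rfl
    · exact hxz'.ne rfl
  · obtain ⟨-, -, h'⟩ := hH.neighbor_of_badLeaf hne hx hxz' hz' (p.takeUntil _ hmem)
      (hp.takeUntil hmem)
    rw [hzK] at h'
    rcases h' with h' | ⟨h', -⟩
    · omega
    · exact Walk.endpoint_notMem_support_takeUntil hp hmem (hne z).symm h'

/-- Let `D` be the set of vertices that are bad leaves of some optimal linkage. If every optimal
linkage has a bad leaf, the exchange shows that `τ` maps neighbours of `D` into `D`. This
contradicts either the expansion of independent sets or the vertex of large degree. -/
theorem exists_isOptimalLinkage_badLeaves_eq_empty (hG : G.Connected)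
    (hτ : ∀ v, G.Adj v (τ v))
    (hI : ∀ I : Set V, I.Nonempty → (∀ u ∈ I, ∀ v ∈ I, ¬ G.Adj u v) →
      I.ncard < {v | ∃ u ∈ I, G.Adj u v}.ncard)
    (hΔ : ∃ v, Nat.card V < 2 * deg G v) :
    ∃ H, IsOptimalLinkage τ G H ∧ badLeaves τ H = ∅ := by
  have hne : ∀ y, τ y ≠ y := fun y => (hτ y).ne'
  have hF : permGraph τ ≤ G := by
    intro u v h
    obtain ⟨-, rfl | rfl⟩ := permGraph_adj.1 h
    · exact hτ u
    · exact (hτ v).symm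
  by_contra! hcon
  set D : Set V := {x | ∃ H, IsOptimalLinkage τ G H ∧ x ∈ badLeaves τ H} with hD
  have hDK : ∀ x ∈ D, τ (τ x) = x := fun x ⟨H, _, hx⟩ => hx.1
  have hDN : ∀ x ∈ D, ∀ z, G.Adj x z → τ (τ z) = z ∧ τ z ∈ D := by
    intro x hx z hxz
    by_cases hz : z = τ x
    · rw [hz, hDK x hx]
      exact ⟨rfl, hx⟩
    · obtain ⟨H, hH, hx⟩ := hx
      obtain ⟨p, hp⟩ := hH.1.2.2.exists_isPath x z
      obtain ⟨h1, h2, -⟩ := hH.neighbor_of_badLeaf hne hx hxz hz p hp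
      exact ⟨h1, h2⟩
  -- This set is independent and its neighbourhood lies in its image under `τ`, so it does not
  -- expand. If it is empty, `D` is closed under `τ`, hence under adjacency, hence is everything.
  by_cases hI0 : {x | x ∈ D ∧ τ x ∉ D}.Nonempty
  · have hlt := hI _ hI0 (fun u hu v hv huv => hv.2 (hDN u hu.1 v huv).2)
    have hsub : {v | ∃ u ∈ {x | x ∈ D ∧ τ x ∉ D}, G.Adj u v} ⊆ τ '' {x | x ∈ D ∧ τ x ∉ D} := by
      rintro v ⟨u, hu, huv⟩
      obtain ⟨h1, h2⟩ := hDN u hu.1 v huv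
      refine ⟨τ v, ⟨h2, ?_⟩, h1⟩
      rw [h1]
      exact fun hv => hu.2 (hDN v hv u huv.symm).2
    have h1 := Set.ncard_le_ncard hsub (Set.toFinite _)
    rw [Set.ncard_image_of_injective _ τ.injective] at h1
    omega
  · rw [Set.not_nonempty_iff_eq_empty] at hI0
    have hDτ : ∀ x ∈ D, τ x ∈ D := by
      intro x hx
      by_contra h
      have : x ∈ {x | x ∈ D ∧ τ x ∉ D} := ⟨hx, h⟩
      rw [hI0] at this
      exact this
    obtain ⟨H, hH⟩ := exists_isOptimalLinkage hG hF
    obtain ⟨x₀, hx₀⟩ := hcon H hH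
    obtain ⟨x, hx⟩ := hΔ
    obtain ⟨H', hH', hxH'⟩ := hG.mem_of_closed (A := D) ⟨H, hH, hx₀⟩ (fun u hu v huv => by
      obtain ⟨h1, h2⟩ := hDN u hu v huv
      rw [← h1]
      exact hDτ _ h2) x
    -- Injecting all neighbours of `x` but `τ x` into its non-neighbours gives `2 deg x ≤ n`.
    have hsub : τ '' (G.neighborSet x \ {τ x}) ⊆ (insert x (G.neighborSet x))ᶜ := by
      rintro _ ⟨z, ⟨hz, hzx⟩, rfl⟩ (h | h)
      · apply hzx
        rw [Set.mem_singleton_iff, ← h]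
        obtain ⟨p, hp⟩ := hH'.1.2.2.exists_isPath x z
        exact ((hDN x ⟨H', hH', hxH'⟩ z hz).1).symm
      · exact hH'.not_adj_of_adj hne hxH' hz hzx h
    have h1 := Set.ncard_le_ncard hsub (Set.toFinite _)
    rw [Set.ncard_image_of_injective _ τ.injective] at h1
    have h2 := Set.ncard_sdiff_singleton_add_one (s := G.neighborSet x) (a := τ x) (hτ x)
      (Set.toFinite _)
    have h3 := Set.ncard_add_ncard_compl (insert x (G.neighborSet x))
    rw [Set.ncard_insert_of_notMem (by simp)] at h3
    unfold deg at hx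
    omega

/-- In an optimal linkage, every edge that is not of the form `{v, τ v}` is a bridge. -/
theorem IsOptimalLinkage.isBridge (hH : IsOptimalLinkage τ G H) {u v : V} (huv : H.Adj u v)
    (h : ¬ (permGraph τ).Adj u v) : H.IsBridge s(u, v) := by
  by_contra hb
  have hc := hH.1.2.2.connected_delete_edge_of_not_isBridge hb
  have hlink : IsLinkage τ G (H.deleteEdges {s(u, v)}) := by
    refine ⟨fun c d hcd => ?_, (deleteEdges_le _).trans hH.1.2.1, hc⟩
    rw [deleteEdges_adj]
    refine ⟨hH.1.1 hcd, ?_⟩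
    rw [Set.mem_singleton_iff, Sym2.eq_iff]
    rintro (⟨rfl, rfl⟩ | ⟨rfl, rfl⟩)
    · exact h hcd
    · exact h hcd.symm
  have hle := hH.2 _ hlink
  simp only [linkageCost, edgeSet_deleteEdges] at hle
  have h1 := Set.ncard_sdiff_singleton_add_one (s := H.edgeSet) (a := s(u, v)) huv (Set.toFinite _)
  -- Removing an edge saves `|V| + 1`, more than any number of new bad leaves can cost.
  have h2 := Set.ncard_le_card (badLeaves τ (H.deleteEdges {s(u, v)}))
  nlinarith

end GoodLinkage

/-! ### Opening the long cycles of the permutation -/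

section OpenCycles

theorem Equiv.Perm.SameCycle.exists_iterate_eq {V : Type*} [Finite V] {τ : Equiv.Perm V}
    {w v : V} (h : τ.SameCycle w v) :
    ∃ i < Function.minimalPeriod τ w, τ^[i] w = v := by
  obtain ⟨i, hi⟩ := h.exists_nat_pow_eq
  refine ⟨i % Function.minimalPeriod τ w, Nat.mod_lt _ ?_, ?_⟩
  · exact Function.minimalPeriod_pos_of_mem_periodicPts (Function.Injective.mem_periodicPts
      τ.injective w)
  · rw [Function.iterate_mod_minimalPeriod_eq, Equiv.Perm.iterate_eq_pow]
    exact hi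

theorem Equiv.Perm.sameCycle_iterate {V : Type*} (τ : Equiv.Perm V) (w : V) (i : ℕ) :
    τ.SameCycle w (τ^[i] w) := by
  rw [Equiv.Perm.iterate_eq_pow, Equiv.Perm.sameCycle_pow_right]

theorem iterate_ne_of_lt_minimalPeriod {V : Type*} {τ : Equiv.Perm V} {w : V} {i : ℕ} (hi : 0 < i)
    (hi' : i < Function.minimalPeriod τ w) : τ^[i] w ≠ w :=
  Function.not_isPeriodicPt_of_pos_of_lt_minimalPeriod hi.ne' hi'

theorem Equiv.Perm.SameCycle.involutive_iff {V : Type*} {τ : Equiv.Perm V} {u v : V}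
    (h : τ.SameCycle u v) : τ (τ u) = u ↔ τ (τ v) = v := by
  obtain ⟨i, rfl⟩ := h
  have : τ (τ ((τ ^ i) u)) = (τ ^ i) (τ (τ u)) := by
    simp only [← Equiv.Perm.mul_apply, ← zpow_one_add, ← zpow_add_one, ← mul_assoc, add_comm]
  rw [this]
  exact ((τ ^ i).injective.eq_iff).symm

variable {V : Type*}

/-- Delete the edges `{w, τ w}` for `w ∈ R`. -/
def openCycles (H : SimpleGraph V) (τ : Equiv.Perm V) (R : Set V) : SimpleGraph V where
  Adj u v := H.Adj u v ∧ ¬ (u ∈ R ∧ v = τ u) ∧ ¬ (v ∈ R ∧ u = τ v)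
  symm := ⟨fun _ _ h => ⟨h.1.symm, h.2.2, h.2.1⟩⟩
  loopless := ⟨fun _ h => h.1.ne rfl⟩

/-- `R` meets every cycle of `τ` that is not a transposition in exactly one vertex, and meets no
transposition. -/
structure IsCycleTransversal (τ : Equiv.Perm V) (R : Set V) : Prop where
  ne_self : ∀ w ∈ R, τ (τ w) ≠ w
  exists_mem : ∀ v, τ (τ v) ≠ v → ∃ w ∈ R, τ.SameCycle w v
  unique : ∀ u ∈ R, ∀ v ∈ R, τ.SameCycle u v → u = v

variable {τ : Equiv.Perm V} {H : SimpleGraph V} {R : Set V}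

theorem openCycles_le : openCycles H τ R ≤ H := fun _ _ h => h.1

theorem IsCycleTransversal.openCycles_adj_apply (hR : IsCycleTransversal τ R)
    (hF : permGraph τ ≤ H) (hne : ∀ y, τ y ≠ y) {v : V} (hv : v ∉ R) :
    (openCycles H τ R).Adj v (τ v) :=
  ⟨hF (permGraph_adj.2 ⟨(hne v).symm, Or.inl rfl⟩), fun h => hv h.1,
    fun h => hR.ne_self _ h.1 (congrArg τ h.2.symm)⟩

theorem openCycles_adj_of_not_permGraph {u v : V} (h : H.Adj u v)
    (hn : ¬ (permGraph τ).Adj u v) : (openCycles H τ R).Adj u v :=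
  ⟨h, fun h' => hn (permGraph_adj.2 ⟨h.ne, Or.inl h'.2.symm⟩),
    fun h' => hn (permGraph_adj.2 ⟨h.ne, Or.inr h'.2.symm⟩)⟩

theorem IsCycleTransversal.iterate_notMem (hR : IsCycleTransversal τ R) {w : V} (hw : w ∈ R)
    {i : ℕ} (hi : 0 < i) (hi' : i < Function.minimalPeriod τ w) : τ^[i] w ∉ R := fun h =>
  iterate_ne_of_lt_minimalPeriod hi hi' (hR.unique w hw _ h (τ.sameCycle_iterate w i)).symm

/-- The ends of a deleted edge remain joined around the rest of their cycle, which loses no other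
edge. -/
theorem IsCycleTransversal.openCycles_connected [Finite V] (hR : IsCycleTransversal τ R)
    (hF : permGraph τ ≤ H) (hne : ∀ y, τ y ≠ y) (hc : H.Connected) :
    (openCycles H τ R).Connected := by
  have key : ∀ w ∈ R, (openCycles H τ R).Reachable (τ w) w := by
    intro w hw
    have h1 : ∀ i, i < Function.minimalPeriod τ w →
        (openCycles H τ R).Reachable (τ w) (τ^[i + 1] w) := by
      intro i
      induction i with
      | zero => intro _; exact Reachable.rfl
      | succ i ih =>
        intro hi
        refine (ih (by omega)).trans ?_
        rw [Function.iterate_succ_apply' _ (i + 1)]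
        exact (hR.openCycles_adj_apply hF hne
          (hR.iterate_notMem hw (Nat.succ_pos i) hi)).reachable
    have hpos : 0 < Function.minimalPeriod τ w := Function.minimalPeriod_pos_of_mem_periodicPts
      (Function.Injective.mem_periodicPts τ.injective w)
    have h2 := h1 (Function.minimalPeriod τ w - 1) (by omega)
    rwa [Nat.sub_add_cancel hpos, Function.iterate_minimalPeriod] at h2
  refine hc.of_adj_reachable fun p q h => ?_
  by_cases h1 : p ∈ R ∧ q = τ p
  · rw [h1.2]; exact (key p h1.1).symm
  · by_cases h2 : q ∈ R ∧ p = τ q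
    · rw [h2.2]; exact key q h2.1
    · exact Adj.reachable ⟨h, h1, h2⟩

theorem SimpleGraph.Walk.mem_of_edges_closed {T : SimpleGraph V} {A : Set V} {a b : V}
    (p : T.Walk a b) (ha : a ∈ A)
    (h : ∀ c d, s(c, d) ∈ p.edges → c ∈ A → d ∈ A) : b ∈ A := by
  induction p with
  | nil => exact ha
  | cons hadj p ih =>
    exact ih (h _ _ (by simp) ha) fun c d hcd => h c d (by simp [hcd])

theorem IsCycleTransversal.openCycles_isBridge_apply [Finite V] (hR : IsCycleTransversal τ R)
    (hb : ∀ u v, H.Adj u v → ¬ (permGraph τ).Adj u v → H.IsBridge s(u, v)) {u : V}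
    (hu : (openCycles H τ R).Adj u (τ u)) : (openCycles H τ R).IsBridge s(u, τ u) := by
  classical
  rw [isBridge_iff, reachable_deleteEdges_iff_exists_walk]
  rintro ⟨p₀, hp₀⟩
  obtain ⟨p, hp, hpe⟩ : ∃ p : (openCycles H τ R).Walk u (τ u), p.IsPath ∧ s(u, τ u) ∉ p.edges :=
    ⟨p₀.bypass, p₀.bypass_isPath, fun h => hp₀ (p₀.edges_bypass_subset_edges h)⟩
  have hcyc : (Walk.cons hu.symm p).IsCycle := by
    rw [Walk.cons_isCycle_iff]
    exact ⟨hp, by rwa [Sym2.eq_swap]⟩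
  -- A bridge cannot lie on the cycle closed by `p`, so `p` uses only `τ`-edges.
  have hF : ∀ c d, s(c, d) ∈ p.edges → (permGraph τ).Adj c d := by
    intro c d hcd
    by_contra hn
    have hadj := p.adj_of_mem_edges hcd
    exact ((hb c d hadj.1 hn).anti openCycles_le).notMem_edges_of_isCycle hcyc (by simp [hcd])
  by_cases hK : τ (τ u) = u
  · have := p.mem_of_edges_closed (A := {u}) rfl (fun c d hcd hc => by
      rw [Set.mem_singleton_iff] at hc
      subst hc
      have := (permGraph_adj_iff_of_involutive hK).1 (hF _ _ hcd)
      rw [this.2] at hcd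
      exact absurd hcd hpe)
    exact hu.1.ne' this
  · obtain ⟨w, hw, hwu⟩ := hR.exists_mem u hK
    obtain ⟨m, hm, rfl⟩ := hwu.exists_iterate_eq
    have hm0 : 0 < m := by
      rcases Nat.eq_zero_or_pos m with rfl | h
      · exact absurd ⟨hw, rfl⟩ hu.2.1
      · exact h
    -- The arc from `τ w` to `u = τ^[m] w` can be left along `τ`-edges only through `{u, τ u}`,
    -- which `p` avoids, or `{w, τ w}`, which is deleted. But `p` ends at `τ u`, outside the arc.
    have := p.mem_of_edges_closed (A := {x | ∃ i, 0 < i ∧ i ≤ m ∧ τ^[i] w = x})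
      ⟨m, hm0, le_rfl, rfl⟩ (by
      rintro c d hcd ⟨i, hi0, him, rfl⟩
      obtain ⟨-, h1 | h1⟩ := permGraph_adj.1 (hF _ _ hcd)
      · rcases Nat.lt_or_ge i m with h2 | h2
        · exact ⟨i + 1, Nat.succ_pos i, h2, by rw [Function.iterate_succ_apply', h1]⟩
        · obtain rfl : i = m := le_antisymm him h2
          rw [← h1] at hcd
          exact absurd hcd hpe
      · obtain ⟨j, rfl⟩ := Nat.exists_eq_succ_of_ne_zero hi0.ne'
        rw [Nat.succ_eq_add_one, Function.iterate_succ_apply'] at h1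
        have h2 := τ.injective h1
        rcases Nat.eq_zero_or_pos j with rfl | hj
        · have h3 := (p.adj_of_mem_edges hcd).2.2
          exact absurd ⟨h2 ▸ hw, by rw [h2]; rfl⟩ h3
        · exact ⟨j, hj, by omega, h2.symm⟩)
    obtain ⟨i, hi0, him, hi⟩ := this
    rw [← Function.iterate_succ_apply' (⇑τ), ← Nat.sub_add_cancel (show i ≤ m.succ by omega),
      Nat.add_comm, Function.iterate_add_apply] at hi
    have := (τ.injective.iterate i) hi
    exact iterate_ne_of_lt_minimalPeriod (by omega) (by omega) this.symm

theorem IsCycleTransversal.openCycles_isTree [Finite V] (hR : IsCycleTransversal τ R)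
    (hF : permGraph τ ≤ H) (hne : ∀ y, τ y ≠ y) (hc : H.Connected)
    (hb : ∀ u v, H.Adj u v → ¬ (permGraph τ).Adj u v → H.IsBridge s(u, v)) :
    (openCycles H τ R).IsTree := by
  refine ⟨hR.openCycles_connected hF hne hc, isAcyclic_iff_forall_adj_isBridge.2 fun u v h => ?_⟩
  by_cases hn : (permGraph τ).Adj u v
  · obtain ⟨-, rfl | rfl⟩ := permGraph_adj.1 hn
    · exact hR.openCycles_isBridge_apply hb h
    · rw [Sym2.eq_swap]
      exact hR.openCycles_isBridge_apply hb h.symm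
  · exact (hb u v h.1 hn).anti openCycles_le

/-- A vertex is an attachment if it is incident with an edge outside `permGraph τ`. -/
def IsAttachment (τ : Equiv.Perm V) (H : SimpleGraph V) (v : V) : Prop :=
  ∃ w, H.Adj v w ∧ ¬ (permGraph τ).Adj v w

/-- A good place to open an odd cycle. -/
def IsGoodOpening (τ : Equiv.Perm V) (H : SimpleGraph V) (w : V) : Prop :=
  IsAttachment τ H w ∧
    (IsAttachment τ H (τ w) ∨ (¬ IsAttachment τ H (τ w) ∧ ¬ IsAttachment τ H (τ (τ w))))

/-- If no opening is good, each attachment is followed by a non-attachment and then an attachment.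
This alternation is impossible around an odd cycle. -/
theorem exists_isGoodOpening {a : V} (ha : IsAttachment τ H a)
    (hodd : ∃ k, Odd k ∧ τ^[k] a = a) : ∃ w, τ.SameCycle a w ∧ IsGoodOpening τ H w := by
  by_contra! hcon
  have key : ∀ i, IsAttachment τ H (τ^[2 * i] a) ∧ ¬ IsAttachment τ H (τ^[2 * i + 1] a) := by
    have step : ∀ i, IsAttachment τ H (τ^[2 * i] a) →
        ¬ IsAttachment τ H (τ^[2 * i + 1] a) ∧ IsAttachment τ H (τ^[2 * (i + 1)] a) := by
      intro i hi
      have := hcon _ (τ.sameCycle_iterate a (2 * i))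
      simp only [IsGoodOpening, ← Function.iterate_succ_apply' (⇑τ)] at this
      have h2 : 2 * (i + 1) = (2 * i).succ.succ := by omega
      rw [h2]
      change ¬ IsAttachment τ H (τ^[(2 * i).succ] a) ∧ _
      tauto
    intro i
    induction i with
    | zero => exact ⟨ha, (step 0 ha).1⟩
    | succ i ih => exact ⟨(step i ih.1).2, (step (i + 1) (step i ih.1).2).1⟩
  obtain ⟨k, ⟨i, rfl⟩, hk⟩ := hodd
  have := (key i).2
  rw [hk] at this
  exact this ha

theorem exists_isCycleTransversal (τ : Equiv.Perm V) (P : V → Prop)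
    (hP : ∀ v, τ (τ v) ≠ v → ∃ w, τ.SameCycle v w ∧ P w) :
    ∃ R : Set V, IsCycleTransversal τ R ∧ ∀ w ∈ R, P w := by
  classical
  let S := Equiv.Perm.SameCycle.setoid τ
  have hq : ∀ q : Quotient S, ∃ w, Quotient.mk S w = q ∧ (τ (τ w) ≠ w → P w) := by
    intro q
    induction q using Quotient.inductionOn with
    | h v =>
      by_cases hv : τ (τ v) = v
      · exact ⟨v, rfl, fun h => absurd hv h⟩
      · obtain ⟨w, hw, hPw⟩ := hP v hv
        exact ⟨w, Quotient.sound (s := S) hw.symm, fun _ => hPw⟩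
  choose f hf hfP using hq
  refine ⟨{v | τ (τ v) ≠ v ∧ f (Quotient.mk S v) = v}, ⟨fun w hw => hw.1, fun v hv => ?_,
    fun u hu v hv huv => ?_⟩, fun w hw => ?_⟩
  · have h1 : τ.SameCycle (f (Quotient.mk S v)) v := Quotient.exact (s := S) (hf _)
    refine ⟨f (Quotient.mk S v), ⟨?_, ?_⟩, h1⟩
    · rwa [Ne, h1.involutive_iff]
    · rw [hf]
  · rw [← hu.2, ← hv.2, Quotient.sound (s := S) huv]
  · have := hfP (Quotient.mk S w)
    rw [hw.2] at this
    exact this hw.1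

end OpenCycles

/-! ### Leaf distance of the opened tree -/

section LeafDistance

variable {V : Type*}

theorem four_le_leafDistance_of_walks {T : SimpleGraph V} (hT : T.Connected)
    (h : ∀ u v, IsLeaf T u → IsLeaf T v → u ≠ v → ∀ p : T.Walk u v, 4 ≤ p.length) :
    4 ≤ leafDistance T := by
  refine le_iInf fun u => le_iInf fun v => le_iInf fun hu => le_iInf fun hv => le_iInf fun huv => ?_
  obtain ⟨p, hp⟩ := hT.exists_walk_length_eq_edist u v
  rw [← hp]
  exact_mod_cast h u v hu hv huv p

theorem four_le_leafDistance {T : SimpleGraph V} (hT : T.Connected)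
    (h1 : ∀ u v, IsLeaf T u → IsLeaf T v → ¬ T.Adj u v)
    (h2 : ∀ u a v, IsLeaf T u → IsLeaf T v → u ≠ v → T.Adj u a → T.Adj a v → False)
    (h3 : ∀ u a b v, IsLeaf T u → IsLeaf T v → u ≠ v → T.Adj u a → T.Adj a b → T.Adj b v →
      b ≠ u → a ≠ v → False) :
    4 ≤ leafDistance T := by
  refine four_le_leafDistance_of_walks hT fun u v hu hv huv p => ?_
  by_contra hlt
  cases p with
  | nil => exact huv rfl
  | @cons _ a _ hua p =>
    cases p with
    | nil => exact h1 _ _ hu hv hua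
    | @cons _ b _ hab p =>
      cases p with
      | nil => exact h2 _ _ _ hu hv huv hua hab
      | @cons _ c _ hbc p =>
        cases p with
        | cons _ _ => simp only [Walk.length_cons] at hlt; omega
        | nil =>
          by_cases hav : a = v
          · subst hav; exact h1 _ _ hu hv hua
          · by_cases hbu : b = u
            · subst hbu; exact h1 _ _ hu hv hbc
            · exact h3 _ _ _ _ hu hv huv hua hab hbc hbu hav

variable {τ : Equiv.Perm V} {H : SimpleGraph V} {R : Set V}

theorem IsCycleTransversal.openCycles_adj_of_involutive (hR : IsCycleTransversal τ R) {u v : V}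
    (hu : τ (τ u) = u) : (openCycles H τ R).Adj u v ↔ H.Adj u v := by
  refine ⟨fun h => h.1, fun h => ⟨h, fun h' => hR.ne_self u h'.1 hu, fun h' => ?_⟩⟩
  have h1 := hR.ne_self v h'.1
  rw [h'.2] at hu
  exact h1 (τ.injective hu)

variable (hR : IsCycleTransversal τ R) (hF : permGraph τ ≤ H) (hne : ∀ y, τ y ≠ y)

include hR hF hne

theorem IsCycleTransversal.leaf_adj_iff_of_involutive {u a : V} (hu : τ (τ u) = u)
    (hl : IsLeaf (openCycles H τ R) u) : (openCycles H τ R).Adj u a ↔ a = τ u := by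
  have h1 : (openCycles H τ R).Adj u (τ u) := (hR.openCycles_adj_of_involutive hu).2
    (hF (permGraph_adj.2 ⟨(hne u).symm, Or.inl rfl⟩))
  exact ⟨fun h => eq_of_deg_eq_one hl h h1, fun h => h ▸ h1⟩

/-- A leaf on an opened cycle is an end of that cycle and not an attachment. -/
theorem IsCycleTransversal.leaf_of_not_involutive {u : V} (hu : τ (τ u) ≠ u)
    (hl : IsLeaf (openCycles H τ R) u) :
    ¬ IsAttachment τ H u ∧ (u ∈ R ∨ (u ∉ R ∧ ∃ w ∈ R, u = τ w)) := by
  obtain ⟨w, rfl⟩ := τ.surjective u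
  have hw : w ∈ R → τ w ∈ R → False := fun h1 h2 => hne w
    (hR.unique w h1 _ h2 (τ.sameCycle_iterate w 1)).symm
  have e1 : τ w ∉ R → (openCycles H τ R).Adj (τ w) (τ (τ w)) := hR.openCycles_adj_apply hF hne
  have e2 : w ∉ R → (openCycles H τ R).Adj (τ w) w :=
    fun h => (hR.openCycles_adj_apply hF hne h).symm
  constructor
  · rintro ⟨x, hx, hxn⟩
    have e3 : (openCycles H τ R).Adj (τ w) x := openCycles_adj_of_not_permGraph hx hxn
    by_cases h1 : w ∈ R
    · have := eq_of_deg_eq_one hl e3 (e1 (hw h1))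
      exact hxn (permGraph_adj.2 ⟨hx.ne, Or.inl this.symm⟩)
    · have := eq_of_deg_eq_one hl e3 (e2 h1)
      exact hxn (permGraph_adj.2 ⟨hx.ne, Or.inr (congrArg τ this)⟩)
  · by_cases h1 : τ w ∈ R
    · exact Or.inl h1
    · refine Or.inr ⟨h1, w, ?_, rfl⟩
      by_contra h2
      have := eq_of_deg_eq_one hl (e1 h1) (e2 h2)
      exact hu (congrArg τ this)

/-- A leaf on a cycle opened at a good place. -/
theorem IsCycleTransversal.leaf_of_isGoodOpening (hg : ∀ w ∈ R, IsGoodOpening τ H w) {u : V}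
    (hu : τ (τ u) ≠ u) (hl : IsLeaf (openCycles H τ R) u) :
    u ∉ R ∧ τ u ∉ R ∧ (∀ a, (openCycles H τ R).Adj u a ↔ a = τ u) ∧
      ∀ b, (openCycles H τ R).Adj (τ u) b → b = u ∨ b = τ (τ u) := by
  obtain ⟨h1, h2⟩ := hR.leaf_of_not_involutive hF hne hu hl
  have huR : u ∉ R := fun h => h1 (hg u h).1
  obtain ⟨w, hw, rfl⟩ : ∃ w ∈ R, u = τ w := by tauto
  have hadj := hR.openCycles_adj_apply hF hne huR
  have h4 : ¬ IsAttachment τ H (τ (τ w)) := by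
    have := (hg w hw).2
    tauto
  refine ⟨huR, fun h => ?_, fun a => ⟨fun h => eq_of_deg_eq_one hl h hadj, fun h => h ▸ hadj⟩,
    fun b hb => ?_⟩
  · have h3 := hR.unique w hw _ h (τ.sameCycle_iterate w 2)
    exact hR.ne_self w hw h3.symm
  · by_contra hcon
    refine h4 ⟨b, hb.1, fun h => hcon ?_⟩
    obtain ⟨-, h5 | h5⟩ := permGraph_adj.1 h
    · exact Or.inr h5.symm
    · exact Or.inl (τ.injective h5)

/-- A leaf on an opened cycle is followed by a vertex with no branches, so no other leaf is within
three steps. Two leaves in transpositions at distance at most three would, absent bad leaves, span a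
component of at most four vertices. -/
theorem IsCycleTransversal.four_le_leafDistance_openCycles [Finite V] (hc : H.Connected)
    (hcard : 5 ≤ Nat.card V) (hbad : badLeaves τ H = ∅) (hg : ∀ w ∈ R, IsGoodOpening τ H w) :
    4 ≤ leafDistance (openCycles H τ R) := by
  have hK : ∀ {u a : V}, τ (τ u) = u → IsLeaf (openCycles H τ R) u →
      ((openCycles H τ R).Adj u a ↔ a = τ u) := fun h h' =>
    hR.leaf_adj_iff_of_involutive hF hne h h'
  have hO : ∀ {u : V}, τ (τ u) ≠ u → IsLeaf (openCycles H τ R) u → _ := fun h h' =>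
    hR.leaf_of_isGoodOpening hF hne hg h h'
  have hKH : ∀ {u a : V}, τ (τ u) = u → IsLeaf (openCycles H τ R) u → (H.Adj u a ↔ a = τ u) :=
    fun h h' => (hR.openCycles_adj_of_involutive h).symm.trans (hK h h')
  have hsmall : ∀ A : Finset V, (∀ v, v ∈ A) → 5 ≤ A.card := by
    intro A hA
    classical
    have := Fintype.ofFinite V
    rw [Nat.card_eq_fintype_card] at hcard
    rwa [Finset.eq_univ_iff_forall.2 hA, Finset.card_univ]
  -- neighbours of leaves on opened cycles are not leaves
  have h1' : ∀ u v, τ (τ u) ≠ u → IsLeaf (openCycles H τ R) u → IsLeaf (openCycles H τ R) v →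
      ¬ (openCycles H τ R).Adj u v := by
    intro u v hu hlu hlv huv
    obtain ⟨-, h2, h3, -⟩ := hO hu hlu
    obtain rfl := (h3 v).1 huv
    exact hu (eq_of_deg_eq_one hlv (hR.openCycles_adj_apply hF hne h2) huv.symm)
  have h2' : ∀ u a v, τ (τ u) ≠ u → IsLeaf (openCycles H τ R) u → IsLeaf (openCycles H τ R) v →
      u ≠ v → (openCycles H τ R).Adj u a → (openCycles H τ R).Adj a v → False := by
    intro u a v hu hlu hlv huv hua hav
    obtain ⟨-, h2, h3, h4⟩ := hO hu hlu
    obtain rfl := (h3 a).1 hua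
    rcases h4 v hav with rfl | rfl
    · exact huv rfl
    · have hv : τ (τ (τ (τ u))) ≠ τ (τ u) := fun h => hu (τ.injective (τ.injective h))
      obtain ⟨-, h5⟩ := hR.leaf_of_not_involutive hF hne hv hlv
      rcases h5 with h5 | ⟨-, w, hw, h6⟩
      · exact (hO hv hlv).1 h5
      · exact h2 (τ.injective h6 ▸ hw)
  have h3' : ∀ u a b v, τ (τ u) ≠ u → IsLeaf (openCycles H τ R) u → IsLeaf (openCycles H τ R) v →
      (openCycles H τ R).Adj u a → (openCycles H τ R).Adj a b → (openCycles H τ R).Adj b v →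
      b ≠ u → a ≠ v → False := by
    intro u a b v hu hlu hlv hua hab hbv hbu hav
    obtain ⟨-, h2, h3, h4⟩ := hO hu hlu
    obtain rfl := (h3 a).1 hua
    rcases h4 b hab with rfl | rfl
    · exact hbu rfl
    -- Any leaf `v` has `τ v` as its sole neighbour, on a transposition or on an opened cycle.
    · have h5 : τ (τ u) = τ v := by
        by_cases hv : τ (τ v) = v
        · exact (hK hv hlv).1 hbv.symm
        · exact ((hO hv hlv).2.2.1 _).1 hbv.symm
      exact hav (τ.injective h5)
  refine four_le_leafDistance (hR.openCycles_connected hF hne hc) ?_ ?_ ?_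
  · intro u v hlu hlv huv
    by_cases hu : τ (τ u) = u
    · by_cases hv : τ (τ v) = v
      · have hv' := (hK hu hlu).1 huv
        have hu' := (hK hv hlv).1 huv.symm
        classical
        have := hsmall {u, v} (fun x => by
          have := hc.mem_of_closed (A := {u, v}) (a := u) (Or.inl rfl) (by
            rintro a (rfl | rfl) b hab
            · exact Or.inr (((hKH hu hlu).1 hab).trans hv'.symm)
            · exact Or.inl (((hKH hv hlv).1 hab).trans hu'.symm)) x
          simpa using this)
        have := Finset.card_le_two (a := u) (b := v)
        omega
      · exact h1' v u hv hlv hlu huv.symm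
    · exact h1' u v hu hlu hlv huv
  · intro u a v hlu hlv huv hua hav
    by_cases hu : τ (τ u) = u
    · by_cases hv : τ (τ v) = v
      · have h5 := (hK hu hlu).1 hua
        have h6 := (hK hv hlv).1 hav.symm
        exact huv (τ.injective (h5.symm.trans h6))
      · exact h2' v a u hv hlv hlu huv.symm hav.symm hua.symm
    · exact h2' u a v hu hlu hlv huv hua hav
  · intro u a b v hlu hlv huv hua hab hbv hbu hav
    by_cases hu : τ (τ u) = u
    · by_cases hv : τ (τ v) = v
      · have h5 := (hK hu hlu).1 hua
        have h6 := (hK hv hlv).1 hbv.symm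
        -- The partner of a leaf in a transposition has degree at most two, because there are no bad
        -- leaves.
        have hnb : ∀ {x y z : V}, τ (τ x) = x → IsLeaf (openCycles H τ R) x → y = τ x →
            H.Adj y z → z ≠ x → ∀ w, H.Adj y w → w = x ∨ w = z := by
          rintro x y z hx hlx rfl hyz hzx w hw
          have hx1 : deg H x = 1 := by
            have : H.neighborSet x = {τ x} := Set.ext fun a => hKH hx hlx
            rw [deg, this, Set.ncard_singleton]
          have hy : ¬ 3 ≤ deg H (τ x) := fun h => by
            have : x ∈ badLeaves τ H := ⟨hx, hx1, h⟩
            rw [hbad] at this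
            exact this
          have hyx : H.Adj (τ x) x := ((hKH hx hlx).2 rfl).symm
          by_contra hcon
          push Not at hcon
          have hsub : ({x, z, w} : Set V) ⊆ H.neighborSet (τ x) := by
            rintro _ (rfl | rfl | rfl)
            · exact hyx
            · exact hyz
            · exact hw
          have := Set.ncard_le_ncard hsub (Set.toFinite _)
          rw [Set.ncard_eq_three.2 ⟨x, z, w, hzx.symm, hcon.1.symm, hcon.2.symm, rfl⟩] at this
          exact hy this
        have ha := hnb hu hlu h5 hab.1 hbu
        have hb := hnb hv hlv h6 hab.1.symm hav
        classical
        have := hsmall {u, a, b, v} (fun x => by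
          have := hc.mem_of_closed (A := {u, a, b, v}) (a := u) (Or.inl rfl) (by
            rintro c (rfl | rfl | rfl | rfl) d hcd
            · exact Or.inr (Or.inl (((hKH hu hlu).1 hcd).trans h5.symm))
            · rcases ha d hcd with rfl | rfl
              · exact Or.inl rfl
              · exact Or.inr (Or.inr (Or.inl rfl))
            · rcases hb d hcd with rfl | rfl
              · exact Or.inr (Or.inr (Or.inr rfl))
              · exact Or.inr (Or.inl rfl)
            · exact Or.inr (Or.inr (Or.inl (((hKH hv hlv).1 hcd).trans h6.symm)))) x
          simpa using this)
        have := Finset.card_le_four (a := u) (b := a) (c := b) (d := v)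
        omega
      · exact h3' v b a u hv hlv hlu hbv.symm hab.symm hua.symm hav hbu
    · exact h3' u a b v hu hlu hlv hua hab hbv hbu hav

/-- The case of a Hamiltonian cycle without further edges. -/
theorem IsCycleTransversal.four_le_leafDistance_openCycles_singleton [Finite V] {w : V}
    (hw : w ∈ R) (hall : ∀ v, τ.SameCycle w v) (hH : H ≤ permGraph τ)
    (hc : H.Connected) (hcard : 5 ≤ Nat.card V) : 4 ≤ leafDistance (openCycles H τ R) := by
  have hper : 5 ≤ Function.minimalPeriod τ w := by
    refine hcard.trans ?_
    have hsurj : Function.Surjective fun i : Fin (Function.minimalPeriod τ w) => τ^[(i : ℕ)] w :=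
      fun v => by
        obtain ⟨i, hi, h⟩ := (hall v).exists_iterate_eq
        exact ⟨⟨i, hi⟩, h⟩
    simpa using Nat.card_le_card_of_surjective _ hsurj
  have hleaf : ∀ u, IsLeaf (openCycles H τ R) u → u = w ∨ u = τ w := by
    intro u hu
    have hO : τ (τ u) ≠ u := by rw [Ne, ← (hall u).involutive_iff]; exact hR.ne_self w hw
    obtain ⟨-, h | ⟨-, v, hv, rfl⟩⟩ := hR.leaf_of_not_involutive hF hne hO hu
    · exact Or.inl (hR.unique w hw u h (hall u)).symm
    · exact Or.inr (congrArg τ (hR.unique w hw v hv (hall v)).symm)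
  -- Along the opened cycle each step changes the exponent by one, and `w` is not reached from `τ w`
  -- before a full turn.
  have key : ∀ (k i : ℕ) (v : V) (p : (openCycles H τ R).Walk (τ^[i] w) v), p.length = k → 0 < i →
      i + k < Function.minimalPeriod τ w → ∃ j, 0 < j ∧ j ≤ i + k ∧ v = τ^[j] w := by
    intro k
    induction k with
    | zero =>
      intro i v p hp hi _
      exact ⟨i, hi, le_rfl, (Walk.eq_of_length_eq_zero hp).symm⟩
    | succ k ih =>
      intro i v p hp hi hik
      cases p with
      | nil => simp at hp
      | @cons _ x _ hx p =>
        rw [Walk.length_cons] at hp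
        obtain ⟨-, h1 | h1⟩ := permGraph_adj.1 (hH hx.1)
        · rw [← Function.iterate_succ_apply' (⇑τ)] at h1
          subst h1
          obtain ⟨j, hj0, hj, rfl⟩ := ih (i + 1) v p (by omega) (by omega) (by omega)
          exact ⟨j, hj0, by omega, rfl⟩
        · obtain ⟨m, rfl⟩ := Nat.exists_eq_succ_of_ne_zero hi.ne'
          rw [Nat.succ_eq_add_one, Function.iterate_succ_apply'] at h1
          obtain rfl := τ.injective h1
          rcases Nat.eq_zero_or_pos m with rfl | hm
          · exact absurd ⟨hw, rfl⟩ hx.2.2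
          · obtain ⟨j, hj0, hj, rfl⟩ := ih m v p (by omega) hm (by omega)
            exact ⟨j, hj0, by omega, rfl⟩
  have key' : ∀ p : (openCycles H τ R).Walk (τ w) w, 4 ≤ p.length := by
    intro p
    by_contra hlt
    obtain ⟨j, hj0, hj, h⟩ := key p.length 1 w p rfl one_pos (by omega)
    exact iterate_ne_of_lt_minimalPeriod hj0 (by omega) h.symm
  refine four_le_leafDistance_of_walks (hR.openCycles_connected hF hne hc)
    fun u v hu hv huv p => ?_
  rcases hleaf u hu with rfl | rfl <;> rcases hleaf v hv with rfl | rfl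
  · exact absurd rfl huv
  · rw [← Walk.length_reverse]; exact key' _
  · exact key' _
  · exact absurd rfl huv

omit hR in
-- If every long cycle carries an attachment, each is odd and has a good opening. A long cycle
-- without attachments is a whole component, so `H` is a Hamiltonian cycle and any opening works.
theorem exists_isTree_of_badLeaves_eq_empty [Finite V] (hc : H.Connected)
    (hcard : 5 ≤ Nat.card V) (hbad : badLeaves τ H = ∅)
    (hb : ∀ u v, H.Adj u v → ¬ (permGraph τ).Adj u v → H.IsBridge s(u, v))
    (hodd : ∀ v, τ (τ v) ≠ v → ∃ k, Odd k ∧ τ^[k] v = v) :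
    ∃ T ≤ H, T.IsTree ∧ 4 ≤ leafDistance T := by
  by_cases hatt : ∀ v, τ (τ v) ≠ v → ∃ a, τ.SameCycle v a ∧ IsAttachment τ H a
  · obtain ⟨R, hR, hg⟩ := exists_isCycleTransversal τ (IsGoodOpening τ H) (by
      intro v hv
      obtain ⟨a, hva, ha⟩ := hatt v hv
      obtain ⟨w, hw, hg⟩ := exists_isGoodOpening ha (hodd a (by rwa [Ne, ← hva.involutive_iff]))
      exact ⟨w, hva.trans hw, hg⟩)
    exact ⟨openCycles H τ R, openCycles_le, hR.openCycles_isTree hF hne hc hb,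
      hR.four_le_leafDistance_openCycles hF hne hc hcard hbad hg⟩
  · push Not at hatt
    obtain ⟨v, hv, hna⟩ := hatt
    obtain ⟨R, hR, -⟩ := exists_isCycleTransversal τ (fun _ => True)
      (fun v _ => ⟨v, Equiv.Perm.SameCycle.refl _ _, trivial⟩)
    obtain ⟨w, hw, hwv⟩ := hR.exists_mem v hv
    have hall : ∀ x, τ.SameCycle v x := by
      refine hc.mem_of_closed (A := {x | τ.SameCycle v x}) (a := v)
        (Equiv.Perm.SameCycle.refl _ _) fun x hx y hxy => ?_
      by_cases hn : (permGraph τ).Adj x y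
      · obtain ⟨-, rfl | rfl⟩ := permGraph_adj.1 hn
        · exact hx.trans (τ.sameCycle_iterate x 1)
        · exact hx.trans (τ.sameCycle_iterate y 1).symm
      · exact absurd ⟨y, hxy, hn⟩ (hna x hx)
    have hH : H ≤ permGraph τ := by
      intro x y hxy
      by_contra hn
      exact hna x (hall x) ⟨y, hxy, hn⟩
    exact ⟨openCycles H τ R, openCycles_le, hR.openCycles_isTree hF hne hc hb,
      hR.four_le_leafDistance_openCycles_singleton hF hne hw (fun x => hwv.trans (hall x)) hH hc
        hcard⟩

end LeafDistance

/-! ### Hamiltonian paths and the extremal case -/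

section HamiltonianPath

/-- Close the path to a cyclic permutation and open it at the last vertex. The closing edge need not
lie in `G`, being the one deleted. -/
theorem exists_isTree_of_hamiltonianPath {V : Type*} [Finite V] {G : SimpleGraph V} {n : ℕ}
    (hcard : Nat.card V = n) (hn : 5 ≤ n) (f : V → ℕ) (hf : Function.Injective f)
    (hfn : ∀ v, f v < n) (hadj : ∀ u v, f u + 1 = f v → G.Adj u v) :
    ∃ T ≤ G, T.IsTree ∧ 4 ≤ leafDistance T := by
  obtain ⟨m, rfl⟩ : ∃ m, n = m + 1 := ⟨n - 1, by omega⟩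
  have hbij : Function.Bijective fun v => (⟨f v, hfn v⟩ : Fin (m + 1)) := by
    rw [Nat.bijective_iff_injective_and_card]
    exact ⟨fun u v h => hf (Fin.mk.inj_iff.1 h), by simpa using hcard⟩
  set e : V ≃ Fin (m + 1) := Equiv.ofBijective _ hbij with he
  have hef : ∀ v, (e v : ℕ) = f v := fun v => rfl
  set τ : Equiv.Perm V := (e.trans (finRotate (m + 1))).trans e.symm with hτ
  have hτf : ∀ v, f (τ v) = if f v = m then 0 else f v + 1 := by
    intro v
    rw [← hef, ← hef, hτ]
    simp only [Equiv.trans_apply, Equiv.apply_symm_apply, finRotate_apply, Fin.val_add_one,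
      Fin.ext_iff, Fin.val_last]
  have hne : ∀ v, τ v ≠ v := by
    intro v hv
    have := hτf v
    rw [hv] at this
    split_ifs at this <;> omega
  set w : V := e.symm (Fin.last m) with hw
  have hwf : f w = m := by rw [← hef, hw, Equiv.apply_symm_apply, Fin.val_last]
  have hiter : ∀ i, i < m + 1 → f (τ^[i + 1] w) = i := by
    intro i
    induction i with
    | zero => intro _; change f (τ w) = 0; rw [hτf, if_pos hwf]
    | succ i ih =>
      intro hi
      rw [Function.iterate_succ_apply', hτf, ih (by omega), if_neg (by omega)]
  have hall : ∀ v, τ.SameCycle w v := by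
    intro v
    have : τ^[f v + 1] w = v := hf (hiter _ (hfn v))
    rw [← this]
    exact τ.sameCycle_iterate w _
  have hR : IsCycleTransversal τ {w} := by
    refine ⟨?_, fun v _ => ⟨w, rfl, hall v⟩, ?_⟩
    · rintro _ rfl h
      have h1 := hiter 1 (by omega)
      change f (τ (τ w)) = 1 at h1
      rw [h, hwf] at h1
      omega
    · rintro _ rfl _ rfl _
      rfl
  have hc : (permGraph τ).Connected := by
    rw [connected_iff_exists_forall_reachable]
    refine ⟨w, fun v => ?_⟩
    obtain ⟨i, -, rfl⟩ := (hall v).exists_iterate_eq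
    induction i with
    | zero => exact Reachable.rfl
    | succ i ih =>
      rw [Function.iterate_succ_apply']
      exact ih.trans (permGraph_adj.2 ⟨(hne _).symm, Or.inl rfl⟩ : (permGraph τ).Adj _ _).reachable
  refine ⟨openCycles (permGraph τ) τ {w}, fun u v h => ?_,
    hR.openCycles_isTree le_rfl hne hc (fun u v h h' => absurd h h'),
    hR.four_le_leafDistance_openCycles_singleton le_rfl hne rfl hall le_rfl hc (by omega)⟩
  have key : ∀ u, ¬ (u ∈ ({w} : Set V)) → G.Adj u (τ u) := by
    intro u hu
    refine hadj _ _ ?_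
    rw [hτf, if_neg]
    exact fun h => hu (hf (h.trans hwf.symm))
  obtain ⟨-, rfl | rfl⟩ := permGraph_adj.1 h.1
  · exact key u fun hu => h.2.1 ⟨hu, rfl⟩
  · exact (key v fun hv => h.2.2 ⟨hv, rfl⟩).symm

/-- The Hamiltonian path alternates between `I` (even positions) and `S` (odd positions), then
leaves the last vertex of `S` for `R`. No consecutive pair lies in `I × I` or between `I` and `R`.
-/
theorem exists_isTree_of_extremal {V : Type*} [Fintype V] [DecidableEq V] {G : SimpleGraph V}
    {n t : ℕ} (hcard : Fintype.card V = n) (hn : 5 ≤ n) {I S : Finset V}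
    (hIS : Disjoint I S) (hI : I.card = t) (hS : S.card = t)
    (hadj : ∀ u v, u ≠ v → (u ∈ I → v ∈ S) → (v ∈ I → u ∈ S) → G.Adj u v) :
    ∃ T ≤ G, T.IsTree ∧ 4 ≤ leafDistance T := by
  set R := (I ∪ S)ᶜ with hR
  have hRc : R.card + 2 * t = n := by
    have h1 := Finset.card_add_card_compl (I ∪ S)
    rw [Finset.card_union_of_disjoint hIS, ← hR] at h1
    omega
  have hRmem : ∀ {v}, v ∉ I → v ∉ S → v ∈ R := fun h1 h2 => by simp [hR, h1, h2]
  let eI := I.equivFinOfCardEq hI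
  let eS := S.equivFinOfCardEq hS
  let eR := R.equivFin
  let f : V → ℕ := fun v => if h : v ∈ I then 2 * (eI ⟨v, h⟩ : ℕ) else
    if h' : v ∈ S then 2 * (eS ⟨v, h'⟩ : ℕ) + 1 else 2 * t + (eR ⟨v, hRmem h h'⟩ : ℕ)
  have fI : ∀ {v} (h : v ∈ I), f v = 2 * (eI ⟨v, h⟩ : ℕ) := fun h => dif_pos h
  have fS : ∀ {v} (h' : v ∉ I) (h : v ∈ S), f v = 2 * (eS ⟨v, h⟩ : ℕ) + 1 := fun h' h => by
    simp only [f, dif_neg h', dif_pos h]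
  have fR : ∀ {v} (h' : v ∉ I) (h : v ∉ S), f v = 2 * t + (eR ⟨v, hRmem h' h⟩ : ℕ) :=
    fun h' h => by simp only [f, dif_neg h', dif_neg h]
  have cases : ∀ v, (v ∈ I ∧ ∃ i < t, f v = 2 * i) ∨ (v ∉ I ∧ v ∈ S ∧ ∃ i < t, f v = 2 * i + 1) ∨
      (v ∉ I ∧ v ∉ S ∧ ∃ i < R.card, f v = 2 * t + i) := by
    intro v
    by_cases h : v ∈ I
    · exact Or.inl ⟨h, _, (eI ⟨v, h⟩).2, fI h⟩
    · by_cases h' : v ∈ S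
      · exact Or.inr (Or.inl ⟨h, h', _, (eS ⟨v, h'⟩).2, fS h h'⟩)
      · exact Or.inr (Or.inr ⟨h, h', _, (eR ⟨v, hRmem h h'⟩).2, fR h h'⟩)
  have hf : Function.Injective f := by
    intro u v huv
    rcases cases u with ⟨hu, i, hi, hui⟩ | ⟨hu, hu', i, hi, hui⟩ | ⟨hu, hu', i, hi, hui⟩ <;>
      rcases cases v with ⟨hv, j, hj, hvj⟩ | ⟨hv, hv', j, hj, hvj⟩ | ⟨hv, hv', j, hj, hvj⟩ <;>
      try omega
    · rw [fI hu, fI hv] at huv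
      exact congrArg Subtype.val (eI.injective (Fin.ext (by omega : (eI ⟨u, hu⟩ : ℕ) = eI ⟨v, hv⟩)))
    · rw [fS hu hu', fS hv hv'] at huv
      exact congrArg Subtype.val (eS.injective (Fin.ext (by omega : (eS ⟨u, hu'⟩ : ℕ) = eS ⟨v, hv'⟩)))
    · rw [fR hu hu', fR hv hv'] at huv
      exact congrArg Subtype.val (eR.injective (Fin.ext (by omega : (eR ⟨u, hRmem hu hu'⟩ : ℕ) =
        eR ⟨v, hRmem hv hv'⟩)))
  refine exists_isTree_of_hamiltonianPath (by rw [Nat.card_eq_fintype_card, hcard]) hn f hf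
    (fun v => ?_) fun u v huv => hadj u v (by rintro rfl; omega) (fun h => ?_) fun h => ?_
  · rcases cases v with ⟨hv, j, hj, hvj⟩ | ⟨hv, hv', j, hj, hvj⟩ | ⟨hv, hv', j, hj, hvj⟩ <;> omega
  · rcases cases u with ⟨hu, i, hi, hui⟩ | ⟨hu, hu', i, hi, hui⟩ | ⟨hu, hu', i, hi, hui⟩ <;>
      rcases cases v with ⟨hv, j, hj, hvj⟩ | ⟨hv, hv', j, hj, hvj⟩ | ⟨hv, hv', j, hj, hvj⟩ <;>
      first
      | assumption
      | exact absurd h hu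
      | omega
  · rcases cases u with ⟨hu, i, hi, hui⟩ | ⟨hu, hu', i, hi, hui⟩ | ⟨hu, hu', i, hi, hui⟩ <;>
      rcases cases v with ⟨hv, j, hj, hvj⟩ | ⟨hv, hv', j, hj, hvj⟩ | ⟨hv, hv', j, hj, hvj⟩ <;>
      first
      | assumption
      | exact absurd h hv
      | omega

end HamiltonianPath

/-! ### A permutation along edges with transpositions and odd cycles -/

section Factor

/-- Hall's condition for `A` reduces to independent sets: with `I` the vertices isolated in `G[A]`,
the neighbourhood of `A` contains the disjoint sets `A \ I` and `N(I)`. -/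
theorem exists_perm_adj {V : Type*} [Finite V] (G : SimpleGraph V)
    (hI : ∀ I : Set V, I.Nonempty → (∀ u ∈ I, ∀ v ∈ I, ¬ G.Adj u v) →
      I.ncard < {v | ∃ u ∈ I, G.Adj u v}.ncard) :
    ∃ σ : Equiv.Perm V, ∀ v, G.Adj v (σ v) := by
  classical
  have := Fintype.ofFinite V
  obtain ⟨f, hf, hfG⟩ := (Finset.all_card_le_biUnion_card_iff_exists_injective
    fun v => Finset.univ.filter (G.Adj v)).1 (by
      intro A
      set I := A.filter fun v => ∀ u ∈ A, ¬ G.Adj v u with hIdef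
      set N := I.biUnion fun v => Finset.univ.filter (G.Adj v) with hN
      have hle : I.card ≤ N.card := by
        rcases I.eq_empty_or_nonempty with h | h
        · rw [h]; simp
        · have h1 := hI (I : Set V) h (fun u hu v hv => by
            rw [Finset.mem_coe, hIdef, Finset.mem_filter] at hu hv
            exact hu.2 v hv.1)
          have h2 : {v | ∃ u ∈ (I : Set V), G.Adj u v} = (N : Set V) := by
            ext v; simp [hN]
          rw [h2, Set.ncard_coe_finset, Set.ncard_coe_finset] at h1
          exact h1.le
      have hdisj : Disjoint (A \ I) N := by
        rw [Finset.disjoint_left]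
        intro v hv hvN
        rw [hN, Finset.mem_biUnion] at hvN
        obtain ⟨u, hu, huv⟩ := hvN
        exact (Finset.mem_filter.1 hu).2 v (Finset.mem_sdiff.1 hv).1 (Finset.mem_filter.1 huv).2
      have hsub : (A \ I) ∪ N ⊆ A.biUnion fun v => Finset.univ.filter (G.Adj v) := by
        refine Finset.union_subset (fun v hv => ?_)
          (Finset.biUnion_subset_biUnion_of_subset_left _ (Finset.filter_subset _ _))
        rw [Finset.mem_sdiff, hIdef, Finset.mem_filter] at hv
        obtain ⟨hvA, hv⟩ := hv
        push Not at hv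
        obtain ⟨u, hu, huv⟩ := hv hvA
        exact Finset.mem_biUnion.2 ⟨u, hu, Finset.mem_filter.2 ⟨Finset.mem_univ _, huv.symm⟩⟩
      have h1 := Finset.card_le_card hsub
      rw [Finset.card_union_of_disjoint hdisj] at h1
      have h2 := Finset.card_sdiff_add_card_eq_card (Finset.filter_subset
        (fun v => ∀ u ∈ A, ¬ G.Adj v u) A)
      rw [← hIdef] at h2
      omega)
  exact ⟨Equiv.ofBijective f (Finite.injective_iff_bijective.1 hf),
    fun v => (Finset.mem_filter.1 (hfG v)).2⟩

/-- Splitting the even cycles of a permutation into transpositions. -/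
theorem exists_perm_involutive_or_odd {V : Type*} [Finite V] (σ : Equiv.Perm V) :
    ∃ τ : Equiv.Perm V, (∀ v, τ v = σ v ∨ τ v = σ.symm v) ∧
      ∀ v, τ (τ v) ≠ v → ∃ k, Odd k ∧ τ^[k] v = v := by
  classical
  let S := Equiv.Perm.SameCycle.setoid σ
  let b : V → V := fun v => (Quotient.mk S v).out
  have hb : ∀ v, σ.SameCycle (b v) v := fun v => Quotient.exact (s := S) (Quotient.out_eq _)
  have hbσ : ∀ v, b (σ v) = b v := fun v => by
    have : Quotient.mk S (σ v) = Quotient.mk S v :=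
      Quotient.sound (s := S) (σ.sameCycle_iterate v 1).symm
    simp only [b, this]
  -- `O` marks the odd cycles, and `E` the vertices at even distance from the base point. On even
  -- cycles `E` alternates, so moving forward from `E` and backward elsewhere is an involution.
  let O : V → Prop := fun v => ∃ k : ℤ, Odd k ∧ (σ ^ k) v = v
  let E : V → Prop := fun v => ∃ k : ℤ, Even k ∧ (σ ^ k) (b v) = v
  have hOσ : ∀ v, O (σ v) ↔ O v := fun v => by
    have : ∀ k : ℤ, (σ ^ k) (σ v) = σ v ↔ (σ ^ k) v = v := fun k => by
      rw [← Equiv.Perm.mul_apply, ← zpow_add_one, add_comm, zpow_one_add, Equiv.Perm.mul_apply,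
        σ.injective.eq_iff]
    simp only [O, this]
  have hEσ : ∀ v, ¬ O v → (E (σ v) ↔ ¬ E v) := by
    intro v hv
    have h1 : E (σ v) ↔ ∃ k : ℤ, Odd k ∧ (σ ^ k) (b v) = v := by
      simp only [E, hbσ]
      constructor
      · rintro ⟨k, hk, h⟩
        refine ⟨k - 1, hk.sub_odd odd_one, σ.injective ?_⟩
        rw [← Equiv.Perm.mul_apply, ← zpow_one_add, add_sub_cancel, h]
      · rintro ⟨k, hk, h⟩
        refine ⟨1 + k, odd_one.add_odd hk, ?_⟩
        rw [zpow_one_add, Equiv.Perm.mul_apply, h]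
    rw [h1]
    constructor
    · rintro ⟨k, hk, h⟩ ⟨l, hl, h'⟩
      refine hv ⟨k - l, hk.sub_even hl, ?_⟩
      nth_rw 1 [← h']
      rw [← Equiv.Perm.mul_apply, ← zpow_add, sub_add_cancel, h]
    · intro h
      obtain ⟨k, hk⟩ := hb v
      refine ⟨k, ?_, hk⟩
      rw [← Int.not_even_iff_odd]
      exact fun hk' => h ⟨k, hk', hk⟩
  let g : V → V := fun v => if O v ∨ E v then σ v else σ.symm v
  have hg : ∀ v, g v = σ v ∨ g v = σ.symm v := fun v => by
    by_cases h : O v ∨ E v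
    · exact Or.inl (if_pos h)
    · exact Or.inr (if_neg h)
  have hOs : ∀ v, O (σ.symm v) ↔ O v := fun v => by
    rw [← hOσ (σ.symm v), Equiv.apply_symm_apply]
  have hOg : ∀ v, O (g v) ↔ O v := fun v => by
    rcases hg v with h | h <;> rw [h]
    · exact hOσ v
    · exact hOs v
  have hgg : ∀ v, ¬ O v → g (g v) = v := by
    intro v hv
    by_cases h : E v
    · have h1 : g v = σ v := if_pos (Or.inr h)
      have h2 : ¬ (O (σ v) ∨ E (σ v)) := by
        rw [hOσ, hEσ v hv]
        exact fun h' => h'.elim hv fun h'' => h'' h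
      rw [h1]
      exact (if_neg h2).trans (σ.symm_apply_apply v)
    · have h1 : g v = σ.symm v := if_neg fun h' => h'.elim hv h
      have h2 : E (σ.symm v) := by
        by_contra h3
        have := (hEσ (σ.symm v) (by rwa [hOs])).2 h3
        rw [Equiv.apply_symm_apply] at this
        exact h this
      rw [h1]
      exact (if_pos (Or.inr h2)).trans (σ.apply_symm_apply v)
  have hgO : ∀ v, O v → g v = σ v := fun v hv => if_pos (Or.inl hv)
  have hinj : Function.Injective g := by
    intro u v h
    by_cases hu : O u
    · have hv : O v := by rwa [← hOg, ← h, hOg]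
      rw [hgO u hu, hgO v hv] at h
      exact σ.injective h
    · have hv : ¬ O v := by rwa [← hOg, ← h, hOg]
      rw [← hgg u hu, h, hgg v hv]
  refine ⟨Equiv.ofBijective g (Finite.injective_iff_bijective.1 hinj), hg, fun v hv => ?_⟩
  have hO : O v := by
    by_contra h
    exact hv (hgg v h)
  obtain ⟨k, hk, hkv⟩ := hO
  refine ⟨k.natAbs, Int.natAbs_odd.2 hk, ?_⟩
  have hiter : ∀ i : ℕ, g^[i] v = (σ ^ i) v ∧ O ((σ ^ i) v) := by
    intro i
    induction i with
    | zero => exact ⟨rfl, k, hk, hkv⟩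
    | succ i ih =>
      rw [Function.iterate_succ_apply', ih.1, pow_succ', Equiv.Perm.mul_apply]
      exact ⟨hgO _ ih.2, (hOσ _).2 ih.2⟩
  refine (hiter _).1.trans ?_
  rcases Int.natAbs_eq k with h | h
  · rw [h, zpow_natCast] at hkv
    exact hkv
  · rw [h, zpow_neg, zpow_natCast, Equiv.Perm.inv_eq_iff_eq] at hkv
    exact hkv.symm

end Factor

/-! ### The combinatorial criterion and the theorem -/

/-- If every nonempty independent set has more neighbours than elements and some vertex is adjacent
to more than half of the vertices, then there is a spanning tree with leaf distance at least four. -/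
theorem exists_isTree_of_card_lt_card_neighbors {V : Type*} [Finite V] {G : SimpleGraph V}
    (hG : G.Connected) (hcard : 5 ≤ Nat.card V)
    (hI : ∀ I : Set V, I.Nonempty → (∀ u ∈ I, ∀ v ∈ I, ¬ G.Adj u v) →
      I.ncard < {v | ∃ u ∈ I, G.Adj u v}.ncard)
    (hΔ : ∃ v, Nat.card V < 2 * deg G v) :
    ∃ T ≤ G, T.IsTree ∧ 4 ≤ leafDistance T := by
  obtain ⟨σ, hσ⟩ := exists_perm_adj G hI
  obtain ⟨τ, hτσ, hodd⟩ := exists_perm_involutive_or_odd σ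
  have hτ : ∀ v, G.Adj v (τ v) := fun v => by
    rcases hτσ v with h | h <;> rw [h]
    · exact hσ v
    · have := (hσ (σ.symm v)).symm
      rwa [Equiv.apply_symm_apply] at this
  obtain ⟨H, hH, hbad⟩ := exists_isOptimalLinkage_badLeaves_eq_empty hG hτ hI hΔ
  obtain ⟨T, hT, h⟩ := exists_isTree_of_badLeaves_eq_empty hH.1.1 (fun v => (hτ v).ne') hH.1.2.2
    hcard hbad (fun u v => hH.isBridge) hodd
  exact ⟨T, hT.trans hH.1.2.1, h⟩

theorem theorem1p5 {V : Type*} [Fintype V] [DecidableEq V] (G : SimpleGraph V) [DecidableRel G.Adj]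
    (n t : ℕ) (hcard : Fintype.card V = n) (ht : 1 ≤ t) (hn : 9 * t + 3 ≤ n)
    (hconn : G.Connected) (hdeg : t ≤ G.minDegree)
    (hη : distanceSignlessLaplacianRadius G ≤
      distanceSignlessLaplacianRadius (extremalGraph n t)) :
    ∃ T : SimpleGraph V, IsSpanningTree T G ∧ 4 ≤ leafDistance T := by
  suffices h : ∃ T ≤ G, T.IsTree ∧ 4 ≤ leafDistance T by
    obtain ⟨T, h1, h2, h3⟩ := h
    exact ⟨T, ⟨h1, h2⟩, h3⟩
  by_cases hI : ∀ I : Set V, I.Nonempty → (∀ u ∈ I, ∀ v ∈ I, ¬ G.Adj u v) →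
      I.ncard < {v | ∃ u ∈ I, G.Adj u v}.ncard
  · refine exists_isTree_of_card_lt_card_neighbors hconn
      (by rw [Nat.card_eq_fintype_card]; omega) hI ?_
    obtain ⟨v, hv⟩ := exists_degree_gt_half_of_radius_lt G hconn (by
      have h1 := radius_extremalGraph_le ht hn
      have h2 : (12 : ℝ) ≤ n := by exact_mod_cast (by omega : 12 ≤ n)
      rw [hcard]
      linarith)
    refine ⟨v, ?_⟩
    rwa [Nat.card_eq_fintype_card, deg, Set.ncard_eq_toFinset_card',
      ← neighborFinset_def, card_neighborFinset_eq_degree]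
  · push Not at hI
    obtain ⟨I, ⟨u, hu⟩, hind, hle⟩ := hI
    classical
    set S : Finset V := Finset.univ.filter fun v => ∃ u ∈ I, G.Adj u v with hS
    have hSc : {v | ∃ u ∈ I, G.Adj u v}.ncard = S.card := by
      rw [← Set.ncard_coe_finset]
      simp [hS]
    rw [hSc, Set.ncard_eq_toFinset_card'] at hle
    -- Shrinking `I` to the size of its neighbourhood keeps all neighbours inside `S`; the degree of
    -- `u ∈ I` gives `|S| ≥ t`.
    obtain ⟨J, hJ, hJc⟩ := Finset.exists_subset_card_eq hle
    have hJI : ∀ v ∈ J, v ∈ I := fun v hv => Set.mem_toFinset.1 (hJ hv)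
    have htS : t ≤ S.card := by
      refine (hdeg.trans (G.minDegree_le_degree u)).trans ?_
      rw [← card_neighborFinset_eq_degree]
      refine Finset.card_le_card fun v hv => ?_
      exact Finset.mem_filter.2 ⟨Finset.mem_univ _, u, hu, (mem_neighborFinset _ _ _).1 hv⟩
    have hdisj : Disjoint J S := by
      rw [Finset.disjoint_left]
      intro v hv hvS
      obtain ⟨w, hw, hwv⟩ := (Finset.mem_filter.1 hvS).2
      exact hind w hw v (hJI v hv) hwv
    obtain ⟨hJt, hadj⟩ := adj_of_radius_le_radius_extremalGraph G hconn hcard ht hn hη hdisj hJc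
      (hJc ▸ htS) (fun v hv w hvw => Finset.mem_filter.2 ⟨Finset.mem_univ _, v, hJI v hv, hvw⟩)
    exact exists_isTree_of_extremal hcard (by omega) hdisj hJt (hJc ▸ hJt) hadj
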